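/- Let $m,n\ge 0$ be integers with $m+n$ even. An $(m,n)$-tangle diagram $D$ is a diagram in the strip $\mathbb R\times[0,1]$ of a tangle in $\mathbb R^2\times[0,1]$ (arcs and circles) with $m$ fixed endpoints on $\mathbb R\times\{0\}$ and $n$ fixed endpoints on $\mathbb R\times\{1\}$, given in general position with respect to the height, i.e. as a vertical stack of cups, caps and crossings. Diagrams are considered up to planar isotopy, generated by exchanging the heights of pieces lying side by side, cancelling a maximum against an adjacent minimum, and sliding a strand across the top of a cap or the bottom of a cup. Two diagrams represent the same $(m,n)$-tangle $T$ if they are related by a finite sequence of planar isotopies and Reidemeister moves R1, R2, R3. Two tangles are 3-equivalent if they have diagrams related by a finite sequence of planar isotopies, Reidemeister moves and $\pm3$-moves, where a $+3$-move or $-3$-move exchanges three half twists (of one or the other handedness) of two parallel strands with two parallel strands. Let $\delta=-q^2-q^{-2}$, and let $E_{m,n}$ be the quotient of the free $\mathbb Z[q,q^{-1}]$-module on planar isotopy classes of $(m,n)$-tangle diagrams by the submodule generated by the elements $D_\times-q\,D_A-q^{-1}D_B$, where $D_A$ and $D_B$ arise from $D_\times$ by the $A$-smoothing (joining the two regions swept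 out when the over-strand is turned counterclockwise) and the $B$-smoothing of one crossing, and by the elements $D\cup\bigcirc-\delta D$. Write $\langle D\rangle\in E_{m,n}$ for the class of $D$, and $\overline D$ for the mirror image of $D$ (all crossings changed). Let $[\ ,\ ]:E_{m,n}\times E_{m,n}\to\mathbb Z[q,q^{-1}]$ be the bilinear form with $[\langle e\rangle,\langle e'\rangle]=\delta^{\ell}$ for diagrams $e,e'$ without crossings, where $\ell$ is the number of closed loops of the plat closure of $e\otimes e'$; here $e\otimes e'$ is $e$ with $e'$ placed to its right, and its plat closure is obtained by joining the $1$st and $2$nd, the $3$rd and $4$th, $\dots$ lower endpoints, and likewise the upper endpoints, by arcs. Put $P(D)=[\langle D\rangle,\langle\overline D\rangle]\in\mathbb Z[q,q^{-1}]$, and for $k\in\{1,5,7,11,13,17,19,23\}$ let $P(D)_k\in\mathbb C$ be the value of $P(D)$ at $q=e^{k\pi i/12}$. **Theorem.** For each $k\in\{1,5,7,11,13,17,19,23\}$, the complex number $P(D)_k$ is invariant under planar isotopy, the Reidemeister moves and the $\pm3$-moves. Hence $P(D)_k$ depends only on the tangle $T$ represented by $D$, and it is a 3-move invariant: it takes the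 same value on any two 3-equivalent $(m,n)$-tangles. -/

import Mathlib

namespace SkeinTangle

/-! ### Tangle diagrams

A tangle diagram in the strip `ℝ × [0,1]`, in general position with respect to the height
coordinate, is a vertical stack of elementary pieces: cups (local minima), caps (local maxima)
and crossings.  It is recorded by the list of these pieces, read from bottom to top.  The strands
met by a horizontal line are numbered `0, 1, 2, …` from left to right. -/

/-- The elementary pieces.  `crossOver` is the crossing whose over-strand runs from the lower left
to the upper right, `crossUnder` is the crossing whose under-strand runs from the lower left to the
upper right. -/
inductive Kind
  | cup
  | cap
  | crossOver
  | crossUnder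

/-- The number of strands that enter an elementary piece from below. -/
def Kind.inputs : Kind → ℕ
  | .cup => 0
  | .cap => 2
  | .crossOver => 2
  | .crossUnder => 2

/-- The number of strands that leave an elementary piece at the top. -/
def Kind.outputs : Kind → ℕ
  | .cup => 2
  | .cap => 0
  | .crossOver => 2
  | .crossUnder => 2

/-- Exchange of over- and under-crossings. -/
def Kind.mirror : Kind → Kind
  | .cup => .cup
  | .cap => .cap
  | .crossOver => .crossUnder
  | .crossUnder => .crossOver

/-- An elementary piece placed in a horizontal slice of the strip, with exactly `pos` vertical
strands to its left (and any number of vertical strands to its right). -/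
structure Piece where
  kind : Kind
  pos : ℕ

/-- The piece moved by `s` strands to the right. -/
def Piece.shift (s : ℕ) (x : Piece) : Piece := ⟨x.kind, s + x.pos⟩

/-- The mirror image of a piece. -/
def Piece.mirror (x : Piece) : Piece := ⟨x.kind.mirror, x.pos⟩

/-- `IsDiagram m w n`: the pieces of `w` can be stacked, starting from `m` endpoints at the bottom
and ending with `n` endpoints at the top. -/
def IsDiagram : ℕ → List Piece → ℕ → Prop
  | m, [], n => m = n
  | m, x :: w, n =>
      x.pos + x.kind.inputs ≤ m ∧ IsDiagram (m - x.kind.inputs + x.kind.outputs) w n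

/-- An `(m, n)`-tangle diagram: `m` endpoints at the bottom and `n` endpoints at the top. (There
are none if `m + n` is odd.) -/
structure TangleDiagram (m n : ℕ) where
  word : List Piece
  isDiagram : IsDiagram m word n

/-! ### Moves

A move is a pair of pictures `(x, y)`; it is applied to a diagram by replacing an occurrence of the
picture `x` by `y`, or `y` by `x`, leaving the rest of the diagram unchanged. -/

/-- `D` contains the picture `x`, and `D'` arises from it on replacing `x` by `y`, where `(x, y)`
is one of the moves `M`. -/
def LocalMove (M : List Piece → List Piece → Prop) {m n : ℕ} (D D' : TangleDiagram m n) : Prop :=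
  ∃ u x y v : List Piece, M x y ∧ D.word = u ++ x ++ v ∧ D'.word = u ++ y ++ v

/-- The moves which generate planar isotopy: exchange of the heights of two pieces that lie side by
side, cancellation of a local maximum against an adjacent local minimum, and sliding a strand that
crosses one leg of a cup or of a cap over to the other leg (the strand stays over, or stays under,
the cup or cap; so the crossing changes between `crossOver` and `crossUnder`). -/
inductive IsotopyMove : List Piece → List Piece → Prop
  | exchange (a b : Kind) (i d : ℕ) :
      IsotopyMove [⟨a, i⟩, ⟨b, i + a.outputs + d⟩] [⟨b, i + a.inputs + d⟩, ⟨a, i⟩]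
  | zigzagLeft (i : ℕ) : IsotopyMove [⟨.cup, i⟩, ⟨.cap, i + 1⟩] []
  | zigzagRight (i : ℕ) : IsotopyMove [⟨.cup, i + 1⟩, ⟨.cap, i⟩] []
  | slideCupOver (i : ℕ) :
      IsotopyMove [⟨.cup, i⟩, ⟨.crossOver, i + 1⟩] [⟨.cup, i + 1⟩, ⟨.crossUnder, i⟩]
  | slideCupUnder (i : ℕ) :
      IsotopyMove [⟨.cup, i⟩, ⟨.crossUnder, i + 1⟩] [⟨.cup, i + 1⟩, ⟨.crossOver, i⟩]
  | slideCapOver (i : ℕ) :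
      IsotopyMove [⟨.crossOver, i + 1⟩, ⟨.cap, i⟩] [⟨.crossUnder, i⟩, ⟨.cap, i + 1⟩]
  | slideCapUnder (i : ℕ) :
      IsotopyMove [⟨.crossUnder, i + 1⟩, ⟨.cap, i⟩] [⟨.crossOver, i⟩, ⟨.cap, i + 1⟩]

/-- `k` is one of the two crossings. -/
def Kind.IsCrossing (k : Kind) : Prop := k = .crossOver ∨ k = .crossUnder

/-- The three Reidemeister moves.  In R3 the three crossings may be chosen freely, except that
one of the three strands has to lie above the two others and one below them; this is the
condition `b = a ∨ b = c`. -/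
inductive ReidemeisterMove : List Piece → List Piece → Prop
  | r1Right (a : Kind) (ha : a.IsCrossing) (i : ℕ) :
      ReidemeisterMove [⟨.cup, i + 1⟩, ⟨a, i⟩, ⟨.cap, i + 1⟩] []
  | r1Left (a : Kind) (ha : a.IsCrossing) (i : ℕ) :
      ReidemeisterMove [⟨.cup, i⟩, ⟨a, i + 1⟩, ⟨.cap, i⟩] []
  | r2 (a : Kind) (ha : a.IsCrossing) (i : ℕ) :
      ReidemeisterMove [⟨a, i⟩, ⟨a.mirror, i⟩] []
  | r3 (a b c : Kind) (ha : a.IsCrossing) (hb : b.IsCrossing) (hc : c.IsCrossing)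
      (h : b = a ∨ b = c) (i : ℕ) :
      ReidemeisterMove [⟨a, i⟩, ⟨b, i + 1⟩, ⟨c, i⟩] [⟨c, i + 1⟩, ⟨b, i⟩, ⟨a, i + 1⟩]

/-- The `+3`-move and the `-3`-move: three half twists of two parallel strands, all in the same
direction, are exchanged for two parallel strands. -/
inductive ThreeMove : List Piece → List Piece → Prop
  | plus (i : ℕ) : ThreeMove [⟨.crossOver, i⟩, ⟨.crossOver, i⟩, ⟨.crossOver, i⟩] []
  | minus (i : ℕ) : ThreeMove [⟨.crossUnder, i⟩, ⟨.crossUnder, i⟩, ⟨.crossUnder, i⟩] []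

/-- One elementary step of an ambient isotopy, seen on diagrams: a planar isotopy move or a
Reidemeister move. -/
def IsotopyStep {m n : ℕ} (D D' : TangleDiagram m n) : Prop :=
  LocalMove IsotopyMove D D' ∨ LocalMove ReidemeisterMove D D'

/-- `(m, n)`-tangles up to ambient isotopy relative to the boundary: tangle diagrams modulo the
equivalence relation generated by planar isotopy and the Reidemeister moves. -/
def Tangle (m n : ℕ) : Type := Quot (IsotopyStep (m := m) (n := n))

/-- The tangle represented by a diagram. -/
def TangleDiagram.tangle {m n : ℕ} (D : TangleDiagram m n) : Tangle m n := Quot.mk _ D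

/-- Two diagrams are 3-equivalent if they are related by a finite sequence of planar isotopies,
Reidemeister moves and `±3`-moves. -/
def TangleDiagram.ThreeEquivalent {m n : ℕ} (D D' : TangleDiagram m n) : Prop :=
  Relation.EqvGen (fun D₁ D₂ => IsotopyStep D₁ D₂ ∨ LocalMove ThreeMove D₁ D₂) D D'

/-- Two tangles are 3-equivalent if they have 3-equivalent diagrams. -/
def Tangle.ThreeEquivalent {m n : ℕ} (S T : Tangle m n) : Prop :=
  ∃ D D' : TangleDiagram m n, D.tangle = S ∧ D'.tangle = T ∧ D.ThreeEquivalent D'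

/-! ### Operations on diagrams -/

theorem isDiagram_append {u v : List Piece} {m n : ℕ} :
    IsDiagram m (u ++ v) n ↔ ∃ k, IsDiagram m u k ∧ IsDiagram k v n := by
  induction u generalizing m with
  | nil => simp [IsDiagram]
  | cons x u ih => simp [IsDiagram, ih, and_assoc]

theorem IsDiagram.mirror {w : List Piece} {m n : ℕ} (h : IsDiagram m w n) :
    IsDiagram m (w.map Piece.mirror) n := by
  induction w generalizing m with
  | nil => exact h
  | cons x w ih =>
    obtain ⟨k, i⟩ := x
    cases k <;> exact ⟨h.1, ih h.2⟩

theorem IsDiagram.add_right {w : List Piece} {m n : ℕ} (h : IsDiagram m w n) (r : ℕ) :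
    IsDiagram (m + r) w (n + r) := by
  induction w generalizing m with
  | nil => exact congrArg (· + r) h
  | cons x w ih =>
    have h1 := h.1
    refine ⟨by omega, ?_⟩
    have e : m + r - x.kind.inputs + x.kind.outputs
        = m - x.kind.inputs + x.kind.outputs + r := by omega
    rw [e]
    exact ih h.2

theorem IsDiagram.shift {w : List Piece} {m n : ℕ} (h : IsDiagram m w n) (s : ℕ) :
    IsDiagram (s + m) (w.map (Piece.shift s)) (s + n) := by
  induction w generalizing m with
  | nil => exact congrArg (s + ·) h
  | cons x w ih =>
    have h1 := h.1
    refine ⟨by simp only [Piece.shift]; omega, ?_⟩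
    have e : s + m - x.kind.inputs + x.kind.outputs
        = s + (m - x.kind.inputs + x.kind.outputs) := by omega
    simp only [Piece.shift, e]
    exact ih h.2

/-- The mirror image of a diagram: over-crossings and under-crossings are exchanged. -/
def TangleDiagram.mirror {m n : ℕ} (D : TangleDiagram m n) : TangleDiagram m n :=
  ⟨D.word.map Piece.mirror, D.isDiagram.mirror⟩

/-- The tensor product: `D'` is placed to the right of `D`. -/
def TangleDiagram.tensor {m n m' n' : ℕ} (D : TangleDiagram m n) (D' : TangleDiagram m' n') :
    TangleDiagram (m + m') (n + n') :=
  ⟨D.word ++ D'.word.map (Piece.shift n),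
    isDiagram_append.2 ⟨n + m', D.isDiagram.add_right m', D'.isDiagram.shift n⟩⟩

/-- `m` cups side by side: they join the points `0, 1`, the points `2, 3`, and so on. -/
def platCups (m : ℕ) : List Piece := (List.range m).map fun j => ⟨.cup, j + j⟩

/-- `n` caps side by side: they join the points `0, 1`, the points `2, 3`, and so on. -/
def platCaps (n : ℕ) : List Piece := List.replicate n ⟨.cap, 0⟩

theorem isDiagram_platCups (m : ℕ) : IsDiagram 0 (platCups m) (m + m) := by
  induction m with
  | zero => rfl
  | succ m ih =>
    rw [platCups, List.range_succ, List.map_append]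
    refine isDiagram_append.2 ⟨_, ih, ?_⟩
    simp [IsDiagram, Kind.inputs, Kind.outputs]
    omega

theorem isDiagram_platCaps (n : ℕ) : IsDiagram (n + n) (platCaps n) 0 := by
  induction n with
  | zero => rfl
  | succ n ih =>
    refine ⟨by simp [Kind.inputs]; omega, ?_⟩
    have e : n + 1 + (n + 1) - Kind.cap.inputs + Kind.cap.outputs = n + n := by
      simp [Kind.inputs, Kind.outputs]; omega
    rw [e]
    exact ih

/-- The plat closure: neighbouring lower endpoints are joined in pairs by arcs, and so are
neighbouring upper endpoints. -/
def TangleDiagram.platClosure {m n : ℕ} (D : TangleDiagram (m + m) (n + n)) : TangleDiagram 0 0 :=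
  ⟨platCups m ++ D.word ++ platCaps n, isDiagram_append.2 ⟨_,
    isDiagram_append.2 ⟨_, isDiagram_platCups m, D.isDiagram⟩, isDiagram_platCaps n⟩⟩

/-- A diagram without crossings. -/
def TangleDiagram.IsCrossingless {m n : ℕ} (D : TangleDiagram m n) : Prop :=
  ∀ x ∈ D.word, ¬ x.kind.IsCrossing

/-! ### Counting closed loops

Read a diagram without lower endpoints from bottom to top.  The part below a horizontal line
consists of closed loops and of arcs which join the points on this line in pairs; the pairing is
recorded by a function `f : ℕ → ℕ` which sends each of these points to the other end of its arc
(and every number that is not one of the points to itself). -/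

/-- The number of a strand after two new strands have been inserted at the places `i`, `i + 1`. -/
def up (i p : ℕ) : ℕ := if p < i then p else p + 2

/-- The number of a strand after the strands `i`, `i + 1` have been deleted. -/
def down (i p : ℕ) : ℕ := if p < i then p else p - 2

/-- The pairing after a cup at `i`: the points `i` and `i + 1` are joined by a new arc. -/
def addArc (i : ℕ) (f : ℕ → ℕ) (p : ℕ) : ℕ :=
  if p = i then i + 1 else if p = i + 1 then i else up i (f (down i p))

/-- The other end of the arc starting at `x`, after the points `i` and `i + 1` have been joined. -/
def splice (i : ℕ) (f : ℕ → ℕ) (x : ℕ) : ℕ :=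
  if f x = i then f (i + 1) else if f x = i + 1 then f i else f x

/-- The pairing after a cap at `i`: the points `i` and `i + 1` have been joined. -/
def joinEnds (i : ℕ) (f : ℕ → ℕ) (p : ℕ) : ℕ := down i (splice i f (up i p))

/-- The pairing after a crossing at `i`: the points `i` and `i + 1` are exchanged. -/
def exchangeEnds (i : ℕ) (f : ℕ → ℕ) (p : ℕ) : ℕ :=
  Equiv.swap i (i + 1) (f (Equiv.swap i (i + 1) p))

/-- The number of loops that are closed by the pieces of `w`, placed on top of a part with pairing
`f`.  A loop is closed by each cap which joins the two ends of one and the same arc. -/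
def loopsFrom : (ℕ → ℕ) → List Piece → ℕ
  | _, [] => 0
  | f, ⟨.cup, i⟩ :: w => loopsFrom (addArc i f) w
  | f, ⟨.cap, i⟩ :: w => (if f i = i + 1 then 1 else 0) + loopsFrom (joinEnds i f) w
  | f, ⟨.crossOver, i⟩ :: w => loopsFrom (exchangeEnds i f) w
  | f, ⟨.crossUnder, i⟩ :: w => loopsFrom (exchangeEnds i f) w

/-- The number of closed loops of a diagram without endpoints. -/
def TangleDiagram.loops (D : TangleDiagram 0 0) : ℕ := loopsFrom id D.word

/-! ### The skein module -/

/-- The ring `ℤ[q, q⁻¹]`. -/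
abbrev Laurent : Type := LaurentPolynomial ℤ

/-- The indeterminate `q`. -/
noncomputable def q : Laurent := LaurentPolynomial.T 1

/-- The inverse of the indeterminate `q`. -/
noncomputable def qInv : Laurent := LaurentPolynomial.T (-1)

/-- The value of a circle, `-q² - q⁻²`. -/
noncomputable def circleValue : Laurent := -q ^ 2 - qInv ^ 2

/-- Tangle diagrams up to planar isotopy. -/
def DiagramClass (m n : ℕ) : Type := Quot (LocalMove IsotopyMove (m := m) (n := n))

/-- The planar isotopy class of a diagram. -/
def TangleDiagram.isotopyClass {m n : ℕ} (D : TangleDiagram m n) : DiagramClass m n := Quot.mk _ D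

/-- The free module generated by the tangle diagrams up to planar isotopy. -/
abbrev FreeDiagrams (m n : ℕ) : Type := DiagramClass m n →₀ Laurent

/-- The generator given by a diagram. -/
noncomputable def TangleDiagram.gen {m n : ℕ} (D : TangleDiagram m n) : FreeDiagrams m n :=
  Finsupp.single D.isotopyClass 1

/-- The elements of the free module that are set to zero: a crossing is resolved into its two
smoothings, and an additional circle is replaced by its value. -/
inductive SkeinRelator (m n : ℕ) : FreeDiagrams m n → Prop
  | crossOver (D D₀ D₁ : TangleDiagram m n) (u v : List Piece) (i : ℕ)
      (h : D.word = u ++ [⟨.crossOver, i⟩] ++ v) (h₀ : D₀.word = u ++ v)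
      (h₁ : D₁.word = u ++ [⟨.cap, i⟩, ⟨.cup, i⟩] ++ v) :
      SkeinRelator m n (D.gen - q • D₀.gen - qInv • D₁.gen)
  | crossUnder (D D₀ D₁ : TangleDiagram m n) (u v : List Piece) (i : ℕ)
      (h : D.word = u ++ [⟨.crossUnder, i⟩] ++ v) (h₀ : D₀.word = u ++ [⟨.cap, i⟩, ⟨.cup, i⟩] ++ v)
      (h₁ : D₁.word = u ++ v) :
      SkeinRelator m n (D.gen - q • D₀.gen - qInv • D₁.gen)
  | circle (D D₀ : TangleDiagram m n) (u v : List Piece) (i : ℕ)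
      (h : D.word = u ++ [⟨.cup, i⟩, ⟨.cap, i⟩] ++ v) (h₀ : D₀.word = u ++ v) :
      SkeinRelator m n (D.gen - circleValue • D₀.gen)

/-- The submodule generated by the skein relations. -/
noncomputable def skeinRelations (m n : ℕ) : Submodule Laurent (FreeDiagrams m n) :=
  Submodule.span Laurent {x | SkeinRelator m n x}

/-- The Kauffman bracket skein module `E_{m,n}`. -/
noncomputable abbrev SkeinModule (m n : ℕ) : Type := FreeDiagrams m n ⧸ skeinRelations m n

/-- The skein class of a diagram. -/
noncomputable def TangleDiagram.skein {m n : ℕ} (D : TangleDiagram m n) : SkeinModule m n :=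
  Submodule.Quotient.mk D.gen

/-! ### The state sum of a closed diagram -/

/-- The sum over all ways to smooth the crossings of `w`, placed on top of a part with pairing `f`,
of the products of the weights `q`, `q⁻¹` of the smoothings, times one factor `-q² - q⁻²` for each
loop that is closed. -/
noncomputable def stateSumFrom : (ℕ → ℕ) → List Piece → Laurent
  | _, [] => 1
  | f, ⟨.cup, i⟩ :: w => stateSumFrom (addArc i f) w
  | f, ⟨.cap, i⟩ :: w => (if f i = i + 1 then circleValue else 1) * stateSumFrom (joinEnds i f) w
  | f, ⟨.crossOver, i⟩ :: w => q * stateSumFrom f w + qInv *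
      ((if f i = i + 1 then circleValue else 1) * stateSumFrom (addArc i (joinEnds i f)) w)
  | f, ⟨.crossUnder, i⟩ :: w => q *
      ((if f i = i + 1 then circleValue else 1) * stateSumFrom (addArc i (joinEnds i f)) w) +
      qInv * stateSumFrom f w

/-- The Kauffman state sum of a diagram without endpoints, where every closed loop contributes a
factor `-q² - q⁻²`. -/
noncomputable def TangleDiagram.stateSum (D : TangleDiagram 0 0) : Laurent := stateSumFrom id D.word

theorem TangleDiagram.stateSum_of_isCrossingless {D : TangleDiagram 0 0} (h : D.IsCrossingless) :
    D.stateSum = circleValue ^ D.loops := by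
  obtain ⟨w, hw⟩ := D
  have key : ∀ (w : List Piece) (f : ℕ → ℕ), (∀ x ∈ w, ¬ x.kind.IsCrossing) →
      stateSumFrom f w = circleValue ^ loopsFrom f w := by
    intro w
    induction w with
    | nil => intro f _; simp [stateSumFrom, loopsFrom]
    | cons x w ih =>
      intro f hx
      have h1 := hx x (by simp)
      have h2 : ∀ g, _ := fun g => ih g fun y hy => hx y (by simp [hy])
      obtain ⟨k, i⟩ := x
      cases k
      · simp [stateSumFrom, loopsFrom, h2]
      · simp only [stateSumFrom, loopsFrom, h2, pow_add]
        split_ifs <;> simp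
      · exact absurd (Or.inl rfl) h1
      · exact absurd (Or.inr rfl) h1
  exact key w id h

theorem down_up (i p : ℕ) : down i (up i p) = p := by unfold down up; split_ifs <;> omega
theorem up_down {i p : ℕ} (h : p ≠ i) (h' : p ≠ i + 1) : up i (down i p) = p := by
  unfold down up; split_ifs <;> omega
theorem up_ne (i p : ℕ) : up i p ≠ i ∧ up i p ≠ i + 1 := by unfold up; split_ifs <;> omega
theorem up_up (i d p : ℕ) : up i (up (i + d) p) = up (i + 2 + d) (up i p) := by
  unfold up; split_ifs <;> omega
theorem up_inj {i p p' : ℕ} : up i p = up i p' ↔ p = p' := by unfold up; split_ifs <;> omega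

/-- `f` is a perfect matching of the points `0, …, n - 1`, and fixes all other numbers. -/
structure Matched (n : ℕ) (f : ℕ → ℕ) : Prop where
  ne : ∀ p, p < n → f p ≠ p
  invol : ∀ p, f (f p) = p
  ge : ∀ p, n ≤ p → f p = p

theorem addArc_up (i f p) : addArc i f (up i p) = up i (f p) := by
  have := up_ne i p
  simp [addArc, this, down_up]

theorem exists_up {i p : ℕ} (h : p ≠ i) (h' : p ≠ i + 1) : ∃ x, p = up i x := ⟨_, (up_down h h').symm⟩

theorem splice_ne {n i f x} (h : Matched n f) (hi : i + 2 ≤ n) (h1 : x ≠ i) (h2 : x ≠ i + 1) :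
    splice i f x ≠ i ∧ splice i f x ≠ i + 1 := by
  have a := h.invol x; have b := h.invol i; have c := h.invol (i+1)
  have d := h.ne i (by omega); have e := h.ne (i+1) (by omega)
  unfold splice; split_ifs <;> constructor <;> intro e <;> simp_all

theorem splice_splice {i f x} (h : ∀ p, f (f p) = p) (h1 : x ≠ i) (h2 : x ≠ i + 1) :
    splice i f (splice i f x) = x := by
  have a := h x; have b := h i; have c := h (i+1)
  unfold splice; split_ifs <;> simp_all

theorem up_joinEnds {n i f} (h : Matched n f) (hi : i + 2 ≤ n) (p) :
    up i (joinEnds i f p) = splice i f (up i p) := by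
  have := splice_ne h hi (up_ne i p).1 (up_ne i p).2
  exact up_down this.1 this.2

theorem splice_addArc {j k k' f z} (h : up j k = k') (h' : up j (k + 1) = k' + 1) :
    splice k' (addArc j f) (up j z) = up j (splice k f z) := by
  unfold splice
  rw [← h', ← h]
  simp only [addArc_up, up_inj]
  split_ifs <;> rfl

theorem Matched.addArc {n f} (h : Matched n f) {i : ℕ} (hi : i ≤ n) :
    Matched (n + 2) (addArc i f) := by
  constructor
  · intro p hp
    by_cases e : p = i
    · simp [SkeinTangle.addArc, e]
    by_cases e' : p = i + 1
    · simp [SkeinTangle.addArc, e']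
    obtain ⟨x, rfl⟩ := exists_up e e'
    rw [addArc_up, Ne, up_inj]
    apply h.ne; unfold up at hp; split_ifs at hp <;> omega
  · intro p
    by_cases e : p = i
    · simp [SkeinTangle.addArc, e]
    by_cases e' : p = i + 1
    · simp [SkeinTangle.addArc, e']
    obtain ⟨x, rfl⟩ := exists_up e e'
    rw [addArc_up, addArc_up, h.invol]
  · intro p hp
    obtain ⟨x, rfl⟩ := exists_up (i := i) (p := p) (by omega) (by omega)
    rw [addArc_up, up_inj]
    apply h.ge; unfold up at hp; split_ifs at hp <;> omega

theorem Matched.joinEnds {n f} (h : Matched (n+2) f) {i : ℕ} (hi : i ≤ n) :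
    Matched n (joinEnds i f) := by
  have hv := h.invol
  have key : ∀ x, x ≠ i → x ≠ i + 1 → f x ≠ x → splice i f x ≠ x := by
    intro x h1 h2 h3
    have a := hv x; have b := hv i; have c := hv (i+1)
    unfold splice; split_ifs <;> intro e <;> simp_all
  constructor
  · intro p hp e
    rw [← up_inj (i := i), up_joinEnds h (by omega)] at e
    refine key _ (up_ne i p).1 (up_ne i p).2 (h.ne _ ?_) e
    unfold up; split_ifs <;> omega
  · intro p
    rw [← up_inj (i := i), up_joinEnds h (by omega), up_joinEnds h (by omega)]
    exact splice_splice hv (up_ne i p).1 (up_ne i p).2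
  · intro p hp
    rw [← up_inj (i := i), up_joinEnds h (by omega)]
    have e : f (up i p) = up i p := h.ge _ (by unfold up; split_ifs <;> omega)
    have := up_ne i p
    simp [splice, e, this]

theorem joinEnds_addArc_self (i : ℕ) (f) : joinEnds i (addArc i f) = f := by
  funext p
  have := up_ne i (f p)
  simp [joinEnds, splice, addArc_up, this, down_up]

theorem joinEnds_addArc_left {n f} (h : Matched n f) (i : ℕ) :
    joinEnds (i + 1) (addArc i f) = f := by
  funext p
  have a := h.invol p; have b := h.invol i
  by_cases e : p = i
  · subst e
    simp +arith [joinEnds, splice, addArc, up, down]; split_ifs <;> omega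
  · have : up (i+1) p = up i p := by unfold up; split_ifs <;> omega
    simp only [joinEnds, splice, this, addArc_up]
    by_cases e' : f p = i
    · rw [e'] at a
      simp +arith [addArc, up, down, e']
    · have h2 : up i (f p) ≠ i + 2 := by unfold up; split_ifs <;> omega
      simp [up_ne i (f p), h2]; unfold up down; split_ifs <;> omega

theorem joinEnds_addArc_right {n f} (h : Matched n f) (i : ℕ) (hi : i < n) :
    joinEnds i (addArc (i + 1) f) = f := by
  funext p
  have a := h.invol p; have b := h.invol i
  by_cases e : p = i
  · subst e
    have := h.ne p hi
    simp +arith [joinEnds, splice, addArc, up, down]; split_ifs <;> omega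
  · have : up i p = up (i+1) p := by unfold up; split_ifs <;> omega
    simp only [joinEnds, splice, this, addArc_up]
    by_cases e' : f p = i
    · rw [e'] at a
      simp +arith [addArc, up, down, e']
    · have h2 : up (i+1) (f p) ≠ i := by unfold up; split_ifs <;> omega
      simp [up_ne (i+1) (f p), h2]; unfold up down; split_ifs <;> omega

theorem addArc_addArc (f) (i d : ℕ) :
    addArc (i + 2 + d) (addArc i f) = addArc i (addArc (i + d) f) := by
  funext p
  by_cases e : p = i
  · subst e; simp [addArc, up, down]; split_ifs <;> omega
  by_cases e' : p = i + 1
  · subst e'; simp [addArc, up, down]; split_ifs <;> omega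
  obtain ⟨x, rfl⟩ := exists_up e e'
  rw [addArc_up i]
  by_cases e : x = i + d
  · subst e; simp [addArc, up]; split_ifs <;> omega
  by_cases e' : x = i + d + 1
  · subst e'; simp [addArc, up]; split_ifs <;> omega
  obtain ⟨y, rfl⟩ := exists_up e e'
  rw [addArc_up, up_up, addArc_up, addArc_up, up_up]

theorem joinEnds_addArc {n f} (h : Matched n f) (i d : ℕ) (hd : i + d + 2 ≤ n) :
    joinEnds (i + 2 + d) (addArc i f) = addArc i (joinEnds (i + d) f) := by
  have h' := h.addArc (i := i) (by omega)
  funext p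
  rw [← up_inj (i := i + 2 + d), up_joinEnds h' (by omega)]
  by_cases e : p = i
  · subst e; simp [addArc, up, splice]; split_ifs <;> omega
  by_cases e' : p = i + 1
  · subst e'; simp [addArc, up, splice]; split_ifs <;> omega
  obtain ⟨x, rfl⟩ := exists_up e e'
  rw [addArc_up, ← up_up, ← up_up, up_joinEnds h hd]
  exact splice_addArc (by unfold up; split_ifs <;> omega) (by unfold up; split_ifs <;> omega)

theorem addArc_joinEnds {n f} (h : Matched n f) (i d : ℕ) (hd : i + d + 2 ≤ n) :
    addArc (i + d) (joinEnds i f) = joinEnds i (addArc (i + 2 + d) f) := by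
  have h' := h.addArc (i := i + 2 + d) (by omega)
  funext p
  rw [← up_inj (i := i), up_joinEnds h' (by omega)]
  by_cases e : p = i + d
  · subst e; simp +arith [addArc, up, splice]
  by_cases e' : p = i + d + 1
  · subst e'; simp +arith [addArc, up, splice]
  obtain ⟨x, rfl⟩ := exists_up e e'
  rw [addArc_up, up_up, up_up, up_joinEnds h (by omega)]
  exact (splice_addArc (by unfold up; split_ifs <;> omega)
    (by unfold up; split_ifs <;> omega)).symm

theorem splice_joinEnds {n f} (h : Matched n f) {i k k' : ℕ} (hi : i + 2 ≤ n) (e : up i k = k')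
    (e' : up i (k + 1) = k' + 1) (p : ℕ) :
    up i (splice k (joinEnds i f) p) =
      if splice i f (up i p) = k' then splice i f (k' + 1)
      else if splice i f (up i p) = k' + 1 then splice i f k' else splice i f (up i p) := by
  rw [← e', ← e, ← up_joinEnds h hi, ← up_joinEnds h hi, ← up_joinEnds h hi]
  simp only [splice, up_inj]
  split_ifs <;> rfl

theorem joinEnds_joinEnds {n f} (h : Matched n f) (i d : ℕ) (hd : i + d + 4 ≤ n) :
    joinEnds (i + d) (joinEnds i f) = joinEnds i (joinEnds (i + 2 + d) f) := by
  obtain ⟨n, rfl⟩ : ∃ k, n = k + 2 := ⟨n - 2, by omega⟩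
  have h1 := h.joinEnds (i := i) (by omega)
  have h2 := h.joinEnds (i := i + 2 + d) (by omega)
  funext p
  rw [← up_inj (i := i + d), ← up_inj (i := i), up_joinEnds h1 (by omega), up_up,
    up_joinEnds h2 (by omega),
    splice_joinEnds h (k' := i + 2 + d) (by omega) (by unfold up; split_ifs <;> omega)
      (by unfold up; split_ifs <;> omega),
    splice_joinEnds h (k' := i) (by omega) (by unfold up; split_ifs <;> omega)
      (by unfold up; split_ifs <;> omega), up_up]
  generalize hz : up (i + 2 + d) (up i p) = z
  have z1 : z ≠ i := by rw [← hz]; unfold up; split_ifs <;> omega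
  have z2 : z ≠ i + 1 := by rw [← hz]; unfold up; split_ifs <;> omega
  have z3 : z ≠ i + 2 + d := by rw [← hz]; unfold up; split_ifs <;> omega
  have z4 : z ≠ i + 2 + d + 1 := by rw [← hz]; unfold up; split_ifs <;> omega
  have a1 := h.invol z
  have a2 := h.invol i
  have a3 := h.invol (i + 1)
  have a4 := h.invol (i + 2 + d)
  have a5 := h.invol (i + 2 + d + 1)
  have b2 := h.ne i (by omega)
  have b3 := h.ne (i + 1) (by omega)
  have b4 := h.ne (i + 2 + d) (by omega)
  have b5 := h.ne (i + 2 + d + 1) (by omega)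
  have c1 : i ≠ i + 2 + d := by omega
  have c2 : i ≠ i + 2 + d + 1 := by omega
  have c3 : i + 1 ≠ i + 2 + d := by omega
  have c4 : i + 1 ≠ i + 2 + d + 1 := by omega
  have c5 : i ≠ i + 1 := by omega
  have c6 : i + 2 + d ≠ i + 2 + d + 1 := by omega
  unfold splice
  generalize i + 2 + d + 1 = t at *
  generalize i + 2 + d = s at *
  generalize i + 1 = j at *
  have e1 : f i = j → f j = i := by grind
  have e2 : f s = t → f t = s := by grind
  clear h h1 h2 hz hd
  grind

/-- The weight of a cap at `i` on top of a part with pairing `f`. -/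
noncomputable def capFactor (f : ℕ → ℕ) (i : ℕ) : Laurent := if f i = i + 1 then circleValue else 1

theorem stateSumFrom_cup (f i w) :
    stateSumFrom f (⟨.cup, i⟩ :: w) = stateSumFrom (addArc i f) w := rfl

theorem stateSumFrom_cap (f i w) :
    stateSumFrom f (⟨.cap, i⟩ :: w) = capFactor f i * stateSumFrom (joinEnds i f) w := rfl

theorem stateSumFrom_over (f i w) :
    stateSumFrom f (⟨.crossOver, i⟩ :: w) =
      q * stateSumFrom f w + qInv * stateSumFrom f (⟨.cap, i⟩ :: ⟨.cup, i⟩ :: w) := rfl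

theorem stateSumFrom_under (f i w) :
    stateSumFrom f (⟨.crossUnder, i⟩ :: w) =
      q * stateSumFrom f (⟨.cap, i⟩ :: ⟨.cup, i⟩ :: w) + qInv * stateSumFrom f w := rfl

/-- Linear relations between state sums are preserved under adding pieces below. -/
theorem stateSumFrom_prefix {u x y z : List Piece} {a b : Laurent} {m k : ℕ} (hu : IsDiagram m u k)
    (H : ∀ g, Matched k g → stateSumFrom g x = a * stateSumFrom g y + b * stateSumFrom g z)
    {f : ℕ → ℕ} (hf : Matched m f) :
    stateSumFrom f (u ++ x) = a * stateSumFrom f (u ++ y) + b * stateSumFrom f (u ++ z) := by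
  induction u generalizing m f with
  | nil => cases hu; exact H f hf
  | cons p u ih =>
    obtain ⟨c, i⟩ := p
    obtain ⟨h1, h2⟩ := hu
    have cross : ∀ (c : Kind), c.inputs = 2 → i + c.inputs ≤ m → Matched m (addArc i (joinEnds i f)) := by
      intro c hc hm
      obtain ⟨m, rfl⟩ : ∃ l, m = l + 2 := ⟨m - 2, by omega⟩
      exact (hf.joinEnds (by omega)).addArc (by omega)
    cases c
    · exact ih h2 (hf.addArc h1)
    · obtain ⟨m, rfl⟩ : ∃ l, m = l + 2 := ⟨m - 2, by simp [Kind.inputs] at h1; omega⟩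
      have := ih h2 (f := joinEnds i f) (by
        simpa [Kind.inputs, Kind.outputs] using hf.joinEnds (by simp [Kind.inputs] at h1; omega))
      simp only [List.cons_append, stateSumFrom_cap, this]
      ring
    · have hm : m - 2 + 2 = m := by simp [Kind.inputs] at h1; omega
      have e := cross .crossOver rfl h1
      simp only [Kind.inputs, Kind.outputs, hm] at h2
      simp only [List.cons_append, stateSumFrom, ih h2 hf, ih h2 e]
      ring
    · have hm : m - 2 + 2 = m := by simp [Kind.inputs] at h1; omega
      have e := cross .crossUnder rfl h1
      simp only [Kind.inputs, Kind.outputs, hm] at h2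
      simp only [List.cons_append, stateSumFrom, ih h2 hf, ih h2 e]
      ring

/-- The state sums of `x` and `y`, placed on top of a part with `k` strands, agree. -/
def SameSum (k : ℕ) (x y : List Piece) : Prop :=
  ∀ f, Matched k f → ∀ v, stateSumFrom f (x ++ v) = stateSumFrom f (y ++ v)

theorem capFactor_addArc {j k k' f} (h : up j k = k') (h' : up j (k + 1) = k' + 1) :
    capFactor (addArc j f) k' = capFactor f k := by
  have e : addArc j f k' = k' + 1 ↔ f k = k + 1 := by rw [← h', ← h, addArc_up, up_inj]
  simp only [capFactor, e]

theorem capFactor_addArc_left (i f) : capFactor (addArc i f) (i + 1) = 1 := by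
  have : addArc i f (i + 1) ≠ i + 1 + 1 := by simp [addArc]; omega
  simp only [capFactor, if_neg this]

theorem capFactor_addArc_right (i f) : capFactor (addArc (i + 1) f) i = 1 := by
  have h := up_ne (i + 1) (f i)
  have : addArc (i + 1) f i ≠ i + 1 := by
    have h1 : i ≠ i + 1 + 1 := by omega
    simpa [addArc, down, h1] using h.1
  simp only [capFactor, if_neg this]

theorem capFactor_capFactor {n f} (h : Matched n f) (i d : ℕ) (hd : i + d + 4 ≤ n) :
    capFactor f i * capFactor (joinEnds i f) (i + d) =
      capFactor f (i + 2 + d) * capFactor (joinEnds (i + 2 + d) f) i := by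
  have e1 : joinEnds i f (i + d) = i + d + 1 ↔ splice i f (i + 2 + d) = i + 2 + d + 1 := by
    rw [← up_inj (i := i), up_joinEnds h (by omega)]
    simp +arith [up]
  have e2 : joinEnds (i + 2 + d) f i = i + 1 ↔ splice (i + 2 + d) f i = i + 1 := by
    rw [← up_inj (i := i + 2 + d), up_joinEnds h (by omega)]
    have h1 : up (i + 2 + d) i = i := by unfold up; split_ifs <;> omega
    have h2 : up (i + 2 + d) (i + 1) = i + 1 := by unfold up; split_ifs <;> omega
    rw [h1, h2]
  unfold capFactor
  simp only [e1, e2]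
  unfold splice
  have a2 := h.invol i
  have a3 := h.invol (i + 1)
  have a4 := h.invol (i + 2 + d)
  have a5 := h.invol (i + 2 + d + 1)
  have c1 : i ≠ i + 2 + d := by omega
  have c2 : i ≠ i + 2 + d + 1 := by omega
  have c3 : i + 1 ≠ i + 2 + d := by omega
  have c4 : i + 1 ≠ i + 2 + d + 1 := by omega
  have c5 : i ≠ i + 1 := by omega
  have c6 : i + 2 + d ≠ i + 2 + d + 1 := by omega
  clear h e1 e2 hd
  generalize i + 2 + d + 1 = t at *
  generalize i + 2 + d = s at *
  generalize i + 1 = j at *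
  by_cases h1 : f i = j
  · by_cases h2 : f s = t <;> grind
  · by_cases h2 : f s = t <;> grind

theorem inputs_cup : Kind.cup.inputs = 0 := rfl
theorem inputs_cap : Kind.cap.inputs = 2 := rfl
theorem outputs_cup : Kind.cup.outputs = 2 := rfl
theorem outputs_cap : Kind.cap.outputs = 0 := rfl

theorem sameSum_exchange_aux {k i d : ℕ} {a b : Kind} (ha : ¬ a.IsCrossing) (hb : ¬ b.IsCrossing)
    (hk : i + a.inputs + d + b.inputs ≤ k) :
    SameSum k [⟨a, i⟩, ⟨b, i + a.outputs + d⟩] [⟨b, i + a.inputs + d⟩, ⟨a, i⟩] := by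
  intro f hf v
  have ho : Kind.crossOver.IsCrossing := Or.inl rfl
  have hu : Kind.crossUnder.IsCrossing := Or.inr rfl
  cases a <;> cases b <;> try contradiction
  · simp only [Kind.inputs, Kind.outputs, List.cons_append, List.nil_append, stateSumFrom_cup,
      Nat.add_zero, addArc_addArc]
  · simp only [Kind.inputs, Kind.outputs, List.cons_append, List.nil_append, stateSumFrom_cup,
      Nat.add_zero, stateSumFrom_cap] at hk ⊢
    rw [joinEnds_addArc hf i d (by omega), capFactor_addArc (k := i + d)]
    all_goals unfold up; split_ifs <;> omega
  · simp only [Kind.inputs, Kind.outputs, List.cons_append, List.nil_append, stateSumFrom_cup,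
      Nat.add_zero, stateSumFrom_cap] at hk ⊢
    rw [addArc_joinEnds hf i d (by omega), capFactor_addArc (k := i)]
    all_goals unfold up; split_ifs <;> omega
  · simp only [Kind.inputs, Kind.outputs, List.cons_append, List.nil_append,
      Nat.add_zero, stateSumFrom_cap] at hk ⊢
    rw [joinEnds_joinEnds hf i d (by omega), ← mul_assoc, ← mul_assoc,
      capFactor_capFactor hf i d (by omega)]

theorem sameSum_zigzagLeft (k i : ℕ) : SameSum k [⟨.cup, i⟩, ⟨.cap, i + 1⟩] [] := by
  intro f hf v
  simp [stateSumFrom_cup, stateSumFrom_cap, capFactor_addArc_left, joinEnds_addArc_left hf]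

theorem sameSum_zigzagRight {k i : ℕ} (hi : i < k) : SameSum k [⟨.cup, i + 1⟩, ⟨.cap, i⟩] [] := by
  intro f hf v
  simp [stateSumFrom_cup, stateSumFrom_cap, capFactor_addArc_right, joinEnds_addArc_right hf i hi]

theorem stateSumFrom_circle (f i v) :
    stateSumFrom f (⟨.cup, i⟩ :: ⟨.cap, i⟩ :: v) = circleValue * stateSumFrom f v := by
  simp [stateSumFrom_cup, stateSumFrom_cap, joinEnds_addArc_self, capFactor, addArc]

theorem SameSum.prefix {k l : ℕ} {u x y : List Piece} (h : SameSum l x y) (hu : IsDiagram k u l) :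
    SameSum k (u ++ x) (u ++ y) := by
  intro f hf v
  have := stateSumFrom_prefix (a := 1) (b := 0) (z := []) (x := x ++ v) (y := y ++ v) hu
    (fun g hg => by simpa using h g hg v) hf
  simpa using this

theorem SameSum.suffix {k : ℕ} {x y : List Piece} (h : SameSum k x y) (w : List Piece) :
    SameSum k (x ++ w) (y ++ w) := by
  intro f hf v
  simpa using h f hf (w ++ v)

theorem SameSum.trans {k : ℕ} {x y z : List Piece} (h : SameSum k x y) (h' : SameSum k y z) :
    SameSum k x z := fun f hf v => (h f hf v).trans (h' f hf v)

/-- A crossing commutes with whatever the two smoothings commute with. -/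
theorem sameSum_exchange_right {k i j j' : ℕ} {a c : Kind} (hc : c.IsCrossing)
    (hv : IsDiagram k [⟨a, i⟩] (k - a.inputs + a.outputs))
    (h : SameSum k [⟨a, i⟩, ⟨.cap, j⟩, ⟨.cup, j⟩] [⟨.cap, j'⟩, ⟨.cup, j'⟩, ⟨a, i⟩]) :
    SameSum k [⟨a, i⟩, ⟨c, j⟩] [⟨c, j'⟩, ⟨a, i⟩] := by
  intro f hf v
  have h := h f hf v
  simp only [List.cons_append, List.nil_append] at h ⊢
  rcases hc with rfl | rfl
  · rw [stateSumFrom_over, ← h]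
    exact stateSumFrom_prefix (u := [⟨a, i⟩]) hv (fun g _ => stateSumFrom_over g j v) hf
  · rw [stateSumFrom_under, ← h]
    exact stateSumFrom_prefix (u := [⟨a, i⟩]) hv (fun g _ => stateSumFrom_under g j v) hf

theorem SameSum.symm {k : ℕ} {x y : List Piece} (h : SameSum k x y) : SameSum k y x :=
  fun f hf v => (h f hf v).symm

theorem sameSum_exchange_half {k i d : ℕ} {a c : Kind} (ha : ¬ a.IsCrossing) (hc : c.IsCrossing)
    (hk : i + a.inputs + d + 2 ≤ k) :
    SameSum k [⟨a, i⟩, ⟨c, i + a.outputs + d⟩] [⟨c, i + a.inputs + d⟩, ⟨a, i⟩] := by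
  refine sameSum_exchange_right hc ⟨by simp; omega, rfl⟩ ?_
  have h1 := sameSum_exchange_aux (k := k) (i := i) (d := d) (b := .cap) ha
    (by simp [Kind.IsCrossing]) (by simpa only [inputs_cap] using hk)
  have h2 := sameSum_exchange_aux (k := k - 2) (i := i) (d := d) (b := .cup) ha
    (by simp [Kind.IsCrossing]) (by simp only [inputs_cup]; omega)
  refine (h1.suffix [⟨.cup, i + a.outputs + d⟩]).trans ?_
  exact h2.prefix (u := [⟨.cap, i + a.inputs + d⟩])
    ⟨by simp only [inputs_cap]; omega, by simp only [IsDiagram, inputs_cap, outputs_cap]; rfl⟩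

theorem sameSum_exchange {k i d : ℕ} {a b : Kind} (hk : i + a.inputs + d + b.inputs ≤ k) :
    SameSum k [⟨a, i⟩, ⟨b, i + a.outputs + d⟩] [⟨b, i + a.inputs + d⟩, ⟨a, i⟩] := by
  by_cases ha : a.IsCrossing
  · have hin : a.inputs = 2 := by rcases ha with rfl | rfl <;> rfl
    have hout : a.outputs = 2 := by rcases ha with rfl | rfl <;> rfl
    have hbk : i + 2 + d + b.inputs ≤ k := by omega
    rw [hin, hout]
    refine (sameSum_exchange_right ha ⟨by simp; omega, rfl⟩ ?_).symm
    have half : ∀ c : Kind, ¬ c.IsCrossing → i + c.inputs + d + b.inputs ≤ k →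
        ∀ l, i + c.inputs + d + b.inputs ≤ l →
        SameSum l [⟨c, i⟩, ⟨b, i + c.outputs + d⟩] [⟨b, i + c.inputs + d⟩, ⟨c, i⟩] := by
      intro c hc _ l hl
      by_cases hb : b.IsCrossing
      · have : b.inputs = 2 := by rcases hb with rfl | rfl <;> rfl
        exact sameSum_exchange_half hc hb (by omega)
      · exact sameSum_exchange_aux hc hb hl
    have h1 := half .cap (by simp [Kind.IsCrossing]) hbk k hbk
    have h2 := half .cup (by simp [Kind.IsCrossing]) (by simp only [inputs_cup]; omega) (k - 2)
      (by simp only [inputs_cup]; omega)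
    refine (h1.symm.suffix [⟨.cup, i⟩]).trans ?_
    exact h2.symm.prefix (u := [⟨.cap, i⟩])
      ⟨by simp only [inputs_cap]; omega, by simp only [IsDiagram, inputs_cap, outputs_cap]; rfl⟩
  · by_cases hb : b.IsCrossing
    · have : b.inputs = 2 := by rcases hb with rfl | rfl <;> rfl
      exact sameSum_exchange_half ha hb (by omega)
    · exact sameSum_exchange_aux ha hb hk

theorem IsotopyMove.sameSum {x y : List Piece} (h : IsotopyMove x y) {k l : ℕ}
    (hx : IsDiagram k x l) : SameSum k x y := by
  cases h with
  | exchange a b i d =>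
    obtain ⟨h1, h2, -⟩ := hx
    simp only at h1 h2
    exact sameSum_exchange (by omega)
  | zigzagLeft i => exact sameSum_zigzagLeft k i
  | zigzagRight i => exact sameSum_zigzagRight hx.1
  | slideCupOver i =>
    obtain ⟨h1, h2, -⟩ := hx
    have hi : i < k := by simp [Kind.inputs, Kind.outputs] at h1 h2; omega
    intro f hf v
    simp only [List.cons_append, List.nil_append, stateSumFrom_cup, stateSumFrom_over,
      stateSumFrom_under, stateSumFrom_cap, capFactor_addArc_left, capFactor_addArc_right,
      joinEnds_addArc_left hf, joinEnds_addArc_right hf i hi]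
    ring
  | slideCupUnder i =>
    obtain ⟨h1, h2, -⟩ := hx
    have hi : i < k := by simp [Kind.inputs, Kind.outputs] at h1 h2; omega
    intro f hf v
    simp only [List.cons_append, List.nil_append, stateSumFrom_cup, stateSumFrom_over,
      stateSumFrom_under, stateSumFrom_cap, capFactor_addArc_left, capFactor_addArc_right,
      joinEnds_addArc_left hf, joinEnds_addArc_right hf i hi]
    ring
  | slideCapOver i =>
    obtain ⟨h1, h2, -⟩ := hx
    obtain ⟨k, rfl⟩ : ∃ r, k = r + 2 := ⟨k - 2, by simp [Kind.inputs] at h1; omega⟩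
    have hi : i < k := by simp [Kind.inputs] at h1; omega
    intro f hf v
    have g1 := hf.joinEnds (i := i) (by omega)
    have g2 := hf.joinEnds (i := i + 1) (by omega)
    simp only [List.cons_append, List.nil_append, stateSumFrom_cup, stateSumFrom_over,
      stateSumFrom_under, stateSumFrom_cap, capFactor_addArc_left, capFactor_addArc_right,
      joinEnds_addArc_left g1, joinEnds_addArc_right g2 i hi]
    ring
  | slideCapUnder i =>
    obtain ⟨h1, h2, -⟩ := hx
    obtain ⟨k, rfl⟩ : ∃ r, k = r + 2 := ⟨k - 2, by simp [Kind.inputs] at h1; omega⟩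
    have hi : i < k := by simp [Kind.inputs] at h1; omega
    intro f hf v
    have g1 := hf.joinEnds (i := i) (by omega)
    have g2 := hf.joinEnds (i := i + 1) (by omega)
    simp only [List.cons_append, List.nil_append, stateSumFrom_cup, stateSumFrom_over,
      stateSumFrom_under, stateSumFrom_cap, capFactor_addArc_left, capFactor_addArc_right,
      joinEnds_addArc_left g1, joinEnds_addArc_right g2 i hi]
    ring

theorem matched_zero_id : Matched 0 id := ⟨by simp, by simp, by simp⟩

/-- A linear relation between pictures, inserted in a diagram without endpoints. -/
theorem stateSum_context {u x y z v : List Piece} {a b : Laurent} {k : ℕ} (hu : IsDiagram 0 u k)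
    (H : ∀ g, Matched k g →
      stateSumFrom g (x ++ v) = a * stateSumFrom g (y ++ v) + b * stateSumFrom g (z ++ v)) :
    stateSumFrom id (u ++ x ++ v) =
      a * stateSumFrom id (u ++ y ++ v) + b * stateSumFrom id (u ++ z ++ v) := by
  simpa using stateSumFrom_prefix hu H matched_zero_id

theorem TangleDiagram.stateSum_isotopy {D D' : TangleDiagram 0 0} (h : LocalMove IsotopyMove D D') :
    D.stateSum = D'.stateSum := by
  obtain ⟨u, x, y, v, hxy, h1, h2⟩ := h
  have hD := D.isDiagram
  rw [h1] at hD
  obtain ⟨l, hl, -⟩ := isDiagram_append.1 hD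
  obtain ⟨k, hu, hx⟩ := isDiagram_append.1 hl
  have := stateSum_context (u := u) (x := x) (y := y) (z := []) (v := v) (a := 1) (b := 0) hu
    (fun g hg => by simpa using hxy.sameSum hx g hg v)
  simpa [stateSum, h1, h2] using this

/-! ### The bilinear form -/

theorem map_shift_cons (s : ℕ) (k : Kind) (i : ℕ) (w : List Piece) :
    (⟨k, i⟩ :: w : List Piece).map (Piece.shift s) = ⟨k, s + i⟩ :: w.map (Piece.shift s) := rfl

theorem IsotopyMove.shift {x y : List Piece} (h : IsotopyMove x y) (s : ℕ) :
    IsotopyMove (x.map (Piece.shift s)) (y.map (Piece.shift s)) := by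
  cases h <;> simp only [map_shift_cons, List.map_nil, ← add_assoc] <;> constructor

theorem LocalMove.platClosure_left {m n : ℕ} {D₁ D₂ : TangleDiagram m n}
    (h : LocalMove IsotopyMove D₁ D₂) (D' : TangleDiagram m n) :
    LocalMove IsotopyMove (D₁.tensor D').platClosure (D₂.tensor D').platClosure := by
  obtain ⟨u, x, y, v, hxy, h1, h2⟩ := h
  exact ⟨platCups m ++ u, x, y, v ++ D'.word.map (Piece.shift n) ++ platCaps n, hxy,
    by simp [TangleDiagram.platClosure, TangleDiagram.tensor, h1],
    by simp [TangleDiagram.platClosure, TangleDiagram.tensor, h2]⟩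

theorem LocalMove.platClosure_right {m n : ℕ} {D₁ D₂ : TangleDiagram m n}
    (h : LocalMove IsotopyMove D₁ D₂) (D : TangleDiagram m n) :
    LocalMove IsotopyMove (D.tensor D₁).platClosure (D.tensor D₂).platClosure := by
  obtain ⟨u, x, y, v, hxy, h1, h2⟩ := h
  exact ⟨platCups m ++ D.word ++ u.map (Piece.shift n), x.map (Piece.shift n),
    y.map (Piece.shift n), v.map (Piece.shift n) ++ platCaps n, hxy.shift n,
    by simp [TangleDiagram.platClosure, TangleDiagram.tensor, h1],
    by simp [TangleDiagram.platClosure, TangleDiagram.tensor, h2]⟩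

/-- The state sum of the plat closure of `D ⊗ D'`, on planar isotopy classes. -/
noncomputable def classPairing {m n : ℕ} (c c' : DiagramClass m n) : Laurent :=
  Quot.lift₂ (fun D D' : TangleDiagram m n => (D.tensor D').platClosure.stateSum)
    (fun D _ _ h => TangleDiagram.stateSum_isotopy (h.platClosure_right D))
    (fun _ _ D' h => TangleDiagram.stateSum_isotopy (h.platClosure_left D')) c c'

/-- The bilinear extension of `classPairing` to the free module. -/
noncomputable def freePairing (m n : ℕ) :
    FreeDiagrams m n →ₗ[Laurent] FreeDiagrams m n →ₗ[Laurent] Laurent :=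
  Finsupp.linearCombination Laurent fun c => Finsupp.linearCombination Laurent fun c' =>
    classPairing c c'

theorem freePairing_gen {m n : ℕ} (D D' : TangleDiagram m n) :
    freePairing m n D.gen D'.gen = (D.tensor D').platClosure.stateSum := by
  rw [freePairing, TangleDiagram.gen, Finsupp.linearCombination_single, one_smul,
    TangleDiagram.gen, Finsupp.linearCombination_single, one_smul]
  rfl

/-- The skein relations between state sums of diagrams without endpoints. -/
theorem stateSum_relations {u y : List Piece} {l : ℕ} (h : IsDiagram 0 (u ++ y) l)
    (v : List Piece) (i : ℕ) :
    (stateSumFrom id (u ++ [⟨.crossOver, i⟩] ++ v) = q * stateSumFrom id (u ++ v) +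
      qInv * stateSumFrom id (u ++ [⟨.cap, i⟩, ⟨.cup, i⟩] ++ v)) ∧
    (stateSumFrom id (u ++ [⟨.crossUnder, i⟩] ++ v) =
      q * stateSumFrom id (u ++ [⟨.cap, i⟩, ⟨.cup, i⟩] ++ v) + qInv * stateSumFrom id (u ++ v)) ∧
    (stateSumFrom id (u ++ [⟨.cup, i⟩, ⟨.cap, i⟩] ++ v) =
      circleValue * stateSumFrom id (u ++ v)) := by
  obtain ⟨r, hu, -⟩ := isDiagram_append.1 h
  have e1 := stateSum_context (v := v) (x := [⟨.crossOver, i⟩]) (y := []) (z := [⟨.cap, i⟩, ⟨.cup, i⟩])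
    (a := q) (b := qInv) hu (fun g _ => stateSumFrom_over g i v)
  have e2 := stateSum_context (v := v) (x := [⟨.crossUnder, i⟩]) (y := [⟨.cap, i⟩, ⟨.cup, i⟩]) (z := [])
    (a := q) (b := qInv) hu (fun g _ => stateSumFrom_under g i v)
  have e3 := stateSum_context (v := v) (x := [⟨.cup, i⟩, ⟨.cap, i⟩]) (y := []) (z := [])
    (a := circleValue) (b := 0) hu
    (fun g _ => by rw [zero_mul, add_zero]; exact stateSumFrom_circle g i v)
  rw [List.append_nil] at e1 e2 e3
  rw [zero_mul, add_zero] at e3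
  exact ⟨e1, e2, e3⟩

theorem word_platClosure_left {m n : ℕ} (D D' : TangleDiagram m n) {u y v : List Piece}
    (h : D.word = u ++ y ++ v) :
    (D.tensor D').platClosure.word = (platCups m ++ u) ++ y ++
      (v ++ D'.word.map (Piece.shift n) ++ platCaps n) := by
  simp [TangleDiagram.platClosure, TangleDiagram.tensor, h]

theorem word_platClosure_right {m n : ℕ} (D D' : TangleDiagram m n) {u y v : List Piece}
    (h : D'.word = u ++ y ++ v) :
    (D.tensor D').platClosure.word = (platCups m ++ D.word ++ u.map (Piece.shift n)) ++
      y.map (Piece.shift n) ++ (v.map (Piece.shift n) ++ platCaps n) := by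
  simp [TangleDiagram.platClosure, TangleDiagram.tensor, h]

theorem freePairing_relator_left {m n : ℕ} {x : FreeDiagrams m n} (hx : SkeinRelator m n x)
    (E : TangleDiagram m n) : freePairing m n x E.gen = 0 := by
  cases hx with
  | crossOver D D₀ D₁ u v i h h₀ h₁ =>
    have h₀ : D₀.word = u ++ [] ++ v := by rw [h₀, List.append_nil]
    have hv := (D.tensor E).platClosure.isDiagram
    rw [word_platClosure_left D E h, List.append_assoc] at hv
    have := (stateSum_relations hv (v ++ E.word.map (Piece.shift n) ++ platCaps n) i).1
    simp only [map_sub, map_smul, LinearMap.sub_apply, LinearMap.smul_apply, freePairing_gen,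
      TangleDiagram.stateSum, word_platClosure_left D E h, word_platClosure_left D₀ E h₀,
      word_platClosure_left D₁ E h₁,  this, smul_eq_mul, List.append_nil]
    ring
  | crossUnder D D₀ D₁ u v i h h₀ h₁ =>
    have h₁ : D₁.word = u ++ [] ++ v := by rw [h₁, List.append_nil]
    have hv := (D.tensor E).platClosure.isDiagram
    rw [word_platClosure_left D E h, List.append_assoc] at hv
    have := (stateSum_relations hv (v ++ E.word.map (Piece.shift n) ++ platCaps n) i).2.1
    simp only [map_sub, map_smul, LinearMap.sub_apply, LinearMap.smul_apply, freePairing_gen,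
      TangleDiagram.stateSum, word_platClosure_left D E h, word_platClosure_left D₀ E h₀,
      word_platClosure_left D₁ E h₁,  this, smul_eq_mul, List.append_nil]
    ring
  | circle D D₀ u v i h h₀ =>
    have h₀ : D₀.word = u ++ [] ++ v := by rw [h₀, List.append_nil]
    have hv := (D.tensor E).platClosure.isDiagram
    rw [word_platClosure_left D E h, List.append_assoc] at hv
    have := (stateSum_relations hv (v ++ E.word.map (Piece.shift n) ++ platCaps n) i).2.2
    simp only [map_sub, map_smul, LinearMap.sub_apply, LinearMap.smul_apply, freePairing_gen,
      TangleDiagram.stateSum, word_platClosure_left D E h, word_platClosure_left D₀ E h₀,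
       this, smul_eq_mul, List.append_nil]
    ring

theorem freePairing_relator_right {m n : ℕ} {x : FreeDiagrams m n} (hx : SkeinRelator m n x)
    (E : TangleDiagram m n) : freePairing m n E.gen x = 0 := by
  cases hx with
  | crossOver D D₀ D₁ u v i h h₀ h₁ =>
    have h₀ : D₀.word = u ++ [] ++ v := by rw [h₀, List.append_nil]
    have hv := (E.tensor D).platClosure.isDiagram
    rw [word_platClosure_right E D h, List.append_assoc] at hv
    have := (stateSum_relations hv (v.map (Piece.shift n) ++ platCaps n) (n + i)).1
    simp only [map_sub, map_smul, freePairing_gen,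
      TangleDiagram.stateSum, word_platClosure_right E D h, word_platClosure_right E D₀ h₀,
      word_platClosure_right E D₁ h₁, map_shift_cons, List.map_nil, this, smul_eq_mul, List.append_nil]
    ring
  | crossUnder D D₀ D₁ u v i h h₀ h₁ =>
    have h₁ : D₁.word = u ++ [] ++ v := by rw [h₁, List.append_nil]
    have hv := (E.tensor D).platClosure.isDiagram
    rw [word_platClosure_right E D h, List.append_assoc] at hv
    have := (stateSum_relations hv (v.map (Piece.shift n) ++ platCaps n) (n + i)).2.1
    simp only [map_sub, map_smul, freePairing_gen,
      TangleDiagram.stateSum, word_platClosure_right E D h, word_platClosure_right E D₀ h₀,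
      word_platClosure_right E D₁ h₁, map_shift_cons, List.map_nil, this, smul_eq_mul, List.append_nil]
    ring
  | circle D D₀ u v i h h₀ =>
    have h₀ : D₀.word = u ++ [] ++ v := by rw [h₀, List.append_nil]
    have hv := (E.tensor D).platClosure.isDiagram
    rw [word_platClosure_right E D h, List.append_assoc] at hv
    have := (stateSum_relations hv (v.map (Piece.shift n) ++ platCaps n) (n + i)).2.2
    simp only [map_sub, map_smul, freePairing_gen,
      TangleDiagram.stateSum, word_platClosure_right E D h, word_platClosure_right E D₀ h₀,
      map_shift_cons, List.map_nil, this, smul_eq_mul, List.append_nil]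
    ring

theorem FreeDiagrams.hom_ext {m n : ℕ} {M : Type*} [AddCommGroup M] [Module Laurent M]
    {f g : FreeDiagrams m n →ₗ[Laurent] M} (h : ∀ D : TangleDiagram m n, f D.gen = g D.gen) :
    f = g := by
  refine Finsupp.lhom_ext' fun c => LinearMap.ext_ring ?_
  induction c using Quot.ind with
  | mk D => exact h D

/-- The bilinear form on the skein module.  On the skein classes of two diagrams it is the state
sum of the plat closure of their tensor product. -/
noncomputable def skeinForm (m n : ℕ) :
    SkeinModule m n →ₗ[Laurent] SkeinModule m n →ₗ[Laurent] Laurent :=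
  ((skeinRelations m n).liftQ
    ((skeinRelations m n).liftQ (freePairing m n) (by
      refine Submodule.span_le.2 fun x hx => ?_
      exact FreeDiagrams.hom_ext fun D => freePairing_relator_left hx D)).flip (by
      refine Submodule.span_le.2 fun x hx => ?_
      refine LinearMap.ext fun y => ?_
      induction y using Submodule.Quotient.induction_on with
      | H y =>
        have : (freePairing m n).flip x = 0 :=
          FreeDiagrams.hom_ext fun D => freePairing_relator_right hx D
        exact LinearMap.congr_fun this y)).flip

theorem skeinForm_skein {m n : ℕ} (D D' : TangleDiagram m n) :
    skeinForm m n D.skein D'.skein = (D.tensor D').platClosure.stateSum :=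
  freePairing_gen D D'

/-- On diagrams without crossings, in particular on the flat diagrams, the value of the form is
`(-q² - q⁻²) ^ ℓ`, where `ℓ` is the number of closed loops of the plat closure. -/
theorem skeinForm_of_isCrossingless {m n : ℕ} {D D' : TangleDiagram m n} (h : D.IsCrossingless)
    (h' : D'.IsCrossingless) :
    skeinForm m n D.skein D'.skein = circleValue ^ (D.tensor D').platClosure.loops := by
  rw [skeinForm_skein]
  refine TangleDiagram.stateSum_of_isCrossingless fun x hx => ?_
  simp only [TangleDiagram.platClosure, TangleDiagram.tensor, List.mem_append, List.mem_map,
    platCups, platCaps, List.mem_replicate] at hx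
  rcases hx with (⟨j, -, rfl⟩ | hx | ⟨y, hy, rfl⟩) | ⟨-, rfl⟩
  · simp [Kind.IsCrossing]
  · exact h x hx
  · exact h' y hy
  · simp [Kind.IsCrossing]

theorem skein_eq_of_relator {m n : ℕ} {x : FreeDiagrams m n} (h : SkeinRelator m n x) :
    (Submodule.Quotient.mk x : SkeinModule m n) = 0 :=
  (Submodule.Quotient.mk_eq_zero _).2 (Submodule.subset_span h)

/-- The skein classes of the diagrams without crossings span the skein module. -/
theorem skein_mem_span {m n : ℕ} (D : TangleDiagram m n) :
    D.skein ∈ Submodule.span Laurent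
      {x : SkeinModule m n | ∃ C : TangleDiagram m n, C.IsCrossingless ∧ C.skein = x} := by
  classical
  generalize hN : D.word.countP (fun x => decide x.kind.IsCrossing) = N
  induction N generalizing D with
  | zero =>
    refine Submodule.subset_span ⟨D, fun x hx => ?_, rfl⟩
    have := List.countP_eq_zero.1 hN x hx
    simpa using this
  | succ N ih =>
    obtain ⟨⟨k, i⟩, hx, hc⟩ := List.countP_pos_iff.1
      (lt_of_lt_of_eq N.succ_pos hN.symm)
    obtain ⟨u, v, h⟩ := List.append_of_mem hx
    have hD := D.isDiagram
    rw [h] at hD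
    obtain ⟨l, hu, hk, hv⟩ := isDiagram_append.1 hD
    have hc : k.IsCrossing := by simpa using hc
    have hl : l - k.inputs + k.outputs = l := by
      rcases hc with rfl | rfl <;> simp [Kind.inputs, Kind.outputs] at hk ⊢ <;> omega
    have hi : i + 2 ≤ l := by
      rcases hc with rfl | rfl <;> simpa [Kind.inputs] using hk
    simp only [hl] at hv
    let D₀ : TangleDiagram m n := ⟨u ++ v, isDiagram_append.2 ⟨l, hu, hv⟩⟩
    let D₁ : TangleDiagram m n := ⟨u ++ [⟨.cap, i⟩, ⟨.cup, i⟩] ++ v, isDiagram_append.2 ⟨l,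
      isDiagram_append.2 ⟨l, hu, hi, by simp only [inputs_cup, inputs_cap, outputs_cap]; omega,
        by simp only [inputs_cup, inputs_cap, outputs_cap, outputs_cup, IsDiagram]; omega⟩, hv⟩⟩
    have i₀ := ih D₀ (by
      rw [h, List.countP_append, List.countP_cons_of_pos (by simpa using hc)] at hN
      simp only [D₀, List.countP_append]; omega)
    have i₁ := ih D₁ (by
      rw [h, List.countP_append, List.countP_cons_of_pos (by simpa using hc)] at hN
      simp [D₁, List.countP_append, Kind.IsCrossing] at hN ⊢; omega)
    rcases hc with rfl | rfl
    · have := skein_eq_of_relator (.crossOver D D₀ D₁ u v i (by simp [h]) rfl rfl)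
      have e : D.skein = q • D₀.skein + qInv • D₁.skein := by
        rw [← sub_eq_zero, ← sub_sub]; exact this
      rw [e]
      exact add_mem (Submodule.smul_mem _ _ i₀) (Submodule.smul_mem _ _ i₁)
    · have := skein_eq_of_relator (.crossUnder D D₁ D₀ u v i (by simp [h]) rfl rfl)
      have e : D.skein = q • D₁.skein + qInv • D₀.skein := by
        rw [← sub_eq_zero, ← sub_sub]; exact this
      rw [e]
      exact add_mem (Submodule.smul_mem _ _ i₁) (Submodule.smul_mem _ _ i₀)

/-- The form is the only bilinear form with these values. -/
theorem skeinForm_unique {m n : ℕ}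
    (B : SkeinModule m n →ₗ[Laurent] SkeinModule m n →ₗ[Laurent] Laurent)
    (hB : ∀ D D' : TangleDiagram m n, D.IsCrossingless → D'.IsCrossingless →
      B D.skein D'.skein = circleValue ^ (D.tensor D').platClosure.loops) :
    B = skeinForm m n := by
  have span : Submodule.span Laurent
      {x : SkeinModule m n | ∃ C : TangleDiagram m n, C.IsCrossingless ∧ C.skein = x} = ⊤ := by
    refine eq_top_iff.2 fun x _ => ?_
    induction x using Submodule.Quotient.induction_on with
    | H x =>
      induction x using Finsupp.induction_linear with
      | zero => exact zero_mem _
      | add x y hx hy => exact add_mem (hx trivial) (hy trivial)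
      | single c a =>
        induction c using Quot.ind with
        | mk D =>
          have : (Finsupp.single (Quot.mk _ D) a : FreeDiagrams m n) = a • D.gen := by
            rw [TangleDiagram.gen, Finsupp.smul_single, smul_eq_mul, mul_one]; rfl
          rw [this]
          exact Submodule.smul_mem _ _ (skein_mem_span D)
  refine LinearMap.ext_on span ?_
  rintro _ ⟨D, hD, rfl⟩
  refine LinearMap.ext_on span ?_
  rintro _ ⟨D', hD', rfl⟩
  rw [hB D D' hD hD', skeinForm_of_isCrossingless hD hD']

/-! ### The invariant -/

/-- The Laurent polynomial `P(D)`: the value of the bilinear form on the skein class of `D` and the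
skein class of its mirror image. -/
noncomputable def TangleDiagram.P {m n : ℕ} (D : TangleDiagram m n) : Laurent :=
  skeinForm m n D.skein D.mirror.skein

/-- The complex number `e^{kπi/12}`, as a unit. -/
noncomputable def rootOfUnity (k : ℕ) : ℂˣ :=
  Units.mk0 (Complex.exp (k * Real.pi * Complex.I / 12)) (Complex.exp_ne_zero _)

/-- The value of `P(D)` at `q = e^{kπi/12}`. -/
noncomputable def TangleDiagram.PAt {m n : ℕ} (D : TangleDiagram m n) (k : ℕ) : ℂ :=
  LaurentPolynomial.eval₂ (Int.castRingHom ℂ) (rootOfUnity k) D.P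

end SkeinTangle

namespace SkeinTangle

/-! `P D` is the Kauffman state sum of the plat closure of `D` placed beside its mirror image. The
mirror image turns every local scaling factor into its inverse, so it suffices that each move
multiplies the state sum by a unit, and the mirrored move by the inverse unit.

Write a crossing as `α + βe`, where `e` is the cap-cup picture and `αβ = 1`; mirroring exchanges `α`
and `β`, and `e² = δe` with `δ = -α² - β²`. Planar isotopy, R2 and R3 have factor `1`, while R1 has
factor `-α³`, whose mirror factor is `-β³`. For three half twists, `(α + βe)³ = α³ + (α - β³ +
β⁷)e`. The coefficient of `e` is a unit times `q⁸ - q⁴ + 1`, the 24th cyclotomic polynomial, and the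
chosen values of `q` are its roots, the primitive 24th roots of unity. There a 3-move just
multiplies by `α³`, and its mirror image by `β³`.

The local computations are `sameSum_r2`, `sameSum_r3`, `proportionalSum_r1Right`,
`proportionalSum_r1Left` and `proportionalSum_threeTwists`. `map_P_eq_of_scalingMove` cancels the
two factors, for any ring homomorphism `φ` out of `ℤ[q, q⁻¹]`, and `rootOfUnity_relation` supplies
the roots. -/

/-! ### Uniform treatment of the two crossings. -/

theorem q_mul_qInv : q * qInv = 1 := by
  rw [q, qInv, ← LaurentPolynomial.T_add]
  simp

/-- The coefficient of the identity in the resolution of a crossing. -/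
noncomputable def Kind.weight : Kind → Laurent
  | .crossOver => q
  | .crossUnder => qInv
  -- A default value: only the weights of the two crossings carry meaning.
  | _ => 0

theorem Kind.IsCrossing.mirror {c : Kind} (hc : c.IsCrossing) : c.mirror.IsCrossing := by
  rcases hc with rfl | rfl
  · exact Or.inr rfl
  · exact Or.inl rfl

theorem Kind.mirror_mirror (c : Kind) : c.mirror.mirror = c := by cases c <;> rfl

theorem Kind.inputs_mirror (c : Kind) : c.mirror.inputs = c.inputs := by cases c <;> rfl

theorem Kind.outputs_mirror (c : Kind) : c.mirror.outputs = c.outputs := by cases c <;> rfl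

theorem Kind.IsCrossing.inputs {c : Kind} (hc : c.IsCrossing) : c.inputs = 2 := by
  rcases hc with rfl | rfl <;> rfl

theorem Kind.IsCrossing.outputs {c : Kind} (hc : c.IsCrossing) : c.outputs = 2 := by
  rcases hc with rfl | rfl <;> rfl

theorem Kind.IsCrossing.weight_mul_mirror {c : Kind} (hc : c.IsCrossing) :
    c.weight * c.mirror.weight = 1 := by
  rcases hc with rfl | rfl
  · exact q_mul_qInv
  · exact (mul_comm _ _).trans q_mul_qInv

/-- The circle value is symmetric in `q` and `q⁻¹`. Together with
`Kind.IsCrossing.weight_mul_mirror` this reduces the local computations to polynomial identities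
modulo `αβ = 1`, valid for both crossings at once. -/
theorem Kind.IsCrossing.circleValue_eq {c : Kind} (hc : c.IsCrossing) :
    circleValue = -c.weight ^ 2 - c.mirror.weight ^ 2 := by
  rcases hc with rfl | rfl
  · rfl
  · simp only [circleValue, Kind.weight, Kind.mirror]
    ring

/-- The smoothing that gives `e` has the inverse weight, which is the weight of the mirrored
crossing. -/
theorem stateSumFrom_crossing {c : Kind} (hc : c.IsCrossing) (f i w) :
    stateSumFrom f (⟨c, i⟩ :: w) = c.weight * stateSumFrom f w +
      c.mirror.weight * stateSumFrom f (⟨.cap, i⟩ :: ⟨.cup, i⟩ :: w) := by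
  rcases hc with rfl | rfl
  · exact stateSumFrom_over f i w
  · exact (stateSumFrom_under f i w).trans (add_comm _ _)

theorem capFactor_addArc_self (i f) : capFactor (addArc i f) i = circleValue := by
  simp [capFactor, addArc]

/-! ### Pictures with proportional state sums -/

/-- On top of a part with `k` strands, the state sum of `x` is `a` times that of `y`, up to
a multiple of a third state sum by a coefficient that `φ` sends to zero. -/
def ProportionalSum {R : Type*} [CommRing R] (φ : Laurent →+* R) (k : ℕ) (a : Laurent)
    (x y : List Piece) : Prop :=
  ∃ (b : Laurent) (z : List Piece), φ b = 0 ∧ ∀ f, Matched k f → ∀ v,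
    stateSumFrom f (x ++ v) = a * stateSumFrom f (y ++ v) + b * stateSumFrom f (z ++ v)

section Proportional

variable {R : Type*} [CommRing R] {φ : Laurent →+* R}

theorem ProportionalSum.of_eq {k : ℕ} {a : Laurent} {x y : List Piece}
    (h : ∀ f, Matched k f → ∀ v, stateSumFrom f (x ++ v) = a * stateSumFrom f (y ++ v)) :
    ProportionalSum φ k a x y :=
  ⟨0, [], map_zero φ, fun f hf v => by rw [h f hf v, zero_mul, add_zero]⟩

theorem SameSum.proportionalSum {k : ℕ} {x y : List Piece} (h : SameSum k x y) :
    ProportionalSum φ k 1 x y :=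
  .of_eq fun f hf v => by rw [h f hf v, one_mul]

/-- Passes from the local relation to a whole closed diagram. The relation holds over `ℤ[q, q⁻¹]`
with its error term, so it can be inserted by `stateSum_context`; only afterwards does `φ` remove
the error term. -/
theorem ProportionalSum.map_stateSumFrom {k : ℕ} {a : Laurent} {x y u : List Piece}
    (h : ProportionalSum φ k a x y) (hu : IsDiagram 0 u k) (v : List Piece) :
    φ (stateSumFrom id (u ++ x ++ v)) = φ a * φ (stateSumFrom id (u ++ y ++ v)) := by
  obtain ⟨b, z, hb, H⟩ := h
  rw [stateSum_context hu fun g hg => H g hg v]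
  simp [hb]

/-! ### The Reidemeister moves and three half twists as Temperley-Lieb identities. -/

/-- In `(α + βe)(β + αe)` the coefficient of `e` is `α² + β² + αβδ`, which vanishes because `αβ =
1`. -/
theorem sameSum_r2 {c : Kind} (hc : c.IsCrossing) (k i : ℕ) :
    SameSum k [⟨c, i⟩, ⟨c.mirror, i⟩] [] := by
  intro f _ v
  have h1 := hc.weight_mul_mirror
  have h2 := hc.circleValue_eq
  simp only [List.cons_append, List.nil_append, stateSumFrom_crossing hc,
    stateSumFrom_crossing hc.mirror, Kind.mirror_mirror, stateSumFrom_cup, stateSumFrom_cap,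
    capFactor_addArc_self, joinEnds_addArc_self, h2]
  linear_combination (stateSumFrom f v - (c.weight ^ 2 + c.mirror.weight ^ 2) * capFactor f i *
    stateSumFrom (addArc i (joinEnds i f)) v) * h1

/-- After both sides are expanded and zigzags straightened, the identity and the two products of
neighbouring cap-cup pictures have equal coefficients. The remaining discrepancy is the same
coefficient, with opposite signs, on the cap-cup pictures at `i` and `i + 1`; it vanishes when the
middle crossing agrees with one of the outer ones. -/
theorem sameSum_r3 {a b c : Kind} (ha : a.IsCrossing) (hb : b.IsCrossing) (hc : c.IsCrossing)
    (h : b = a ∨ b = c) {k i : ℕ} (hi : i + 3 ≤ k) :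
    SameSum k [⟨a, i⟩, ⟨b, i + 1⟩, ⟨c, i⟩] [⟨c, i + 1⟩, ⟨b, i⟩, ⟨a, i + 1⟩] := by
  intro f hf v
  obtain ⟨k, rfl⟩ : ∃ r, k = r + 2 := ⟨k - 2, by omega⟩
  have g1 := hf.joinEnds (i := i) (by omega)
  have g2 := hf.joinEnds (i := i + 1) (by omega)
  -- The relations for `b` alone suffice: the outer crossing equal to `b` shares its weights, and
  -- the other one enters linearly.
  have h1 := hb.weight_mul_mirror
  have h2 := hb.circleValue_eq
  simp only [List.cons_append, List.nil_append, stateSumFrom_crossing ha,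
    stateSumFrom_crossing hb, stateSumFrom_crossing hc, stateSumFrom_cup, stateSumFrom_cap,
    capFactor_addArc_self, joinEnds_addArc_self, capFactor_addArc_left, capFactor_addArc_right,
    joinEnds_addArc_left g1, joinEnds_addArc_left g2,
    joinEnds_addArc_right g1 i (show i < k by omega),
    joinEnds_addArc_right g2 i (show i < k by omega), h2]
  rcases h with rfl | rfl
  · linear_combination (- c.mirror.weight * (b.weight ^ 2 + b.mirror.weight ^ 2)) *
      (capFactor f i * stateSumFrom (addArc i (joinEnds i f)) v -
        capFactor f (i + 1) * stateSumFrom (addArc (i + 1) (joinEnds (i + 1) f)) v) * h1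
  · linear_combination (- a.mirror.weight * (b.weight ^ 2 + b.mirror.weight ^ 2)) *
      (capFactor f i * stateSumFrom (addArc i (joinEnds i f)) v -
        capFactor f (i + 1) * stateSumFrom (addArc (i + 1) (joinEnds (i + 1) f)) v) * h1

/-- One smoothing splits off a circle and the other leaves a zigzag that straightens, so the factor
is `αδ + β = -α³`. -/
theorem proportionalSum_r1Right {c : Kind} (hc : c.IsCrossing) {k i : ℕ} (hi : i < k) :
    ProportionalSum φ k (-c.weight ^ 3) [⟨.cup, i + 1⟩, ⟨c, i⟩, ⟨.cap, i + 1⟩] [] := by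
  refine .of_eq fun f hf v => ?_
  simp only [List.cons_append, List.nil_append, stateSumFrom_crossing hc, stateSumFrom_cup,
    stateSumFrom_cap, capFactor_addArc_self, joinEnds_addArc_self, capFactor_addArc_left,
    capFactor_addArc_right, joinEnds_addArc_left hf, joinEnds_addArc_right hf i hi,
    hc.circleValue_eq]
  linear_combination (-c.mirror.weight * stateSumFrom f v) * hc.weight_mul_mirror

theorem proportionalSum_r1Left {c : Kind} (hc : c.IsCrossing) {k i : ℕ} (hi : i < k) :
    ProportionalSum φ k (-c.weight ^ 3) [⟨.cup, i⟩, ⟨c, i + 1⟩, ⟨.cap, i⟩] [] := by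
  refine .of_eq fun f hf v => ?_
  simp only [List.cons_append, List.nil_append, stateSumFrom_crossing hc, stateSumFrom_cup,
    stateSumFrom_cap, capFactor_addArc_self, joinEnds_addArc_self, capFactor_addArc_left,
    capFactor_addArc_right, joinEnds_addArc_left hf, joinEnds_addArc_right hf i hi,
    hc.circleValue_eq]
  linear_combination (-c.mirror.weight * stateSumFrom f v) * hc.weight_mul_mirror

/-- The only place where the special values of `q` matter: the cap-cup term of the cube of a
crossing has to disappear. -/
theorem proportionalSum_threeTwists (hφ : φ (q ^ 8 - q ^ 4 + 1) = 0) {c : Kind}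
    (hc : c.IsCrossing) (k i : ℕ) :
    ProportionalSum φ k (c.weight ^ 3) [⟨c, i⟩, ⟨c, i⟩, ⟨c, i⟩] [] := by
  have h1 := hc.weight_mul_mirror
  -- This is the coefficient of `e` in `(α + βe)³`, reduced with `αβ = 1`. For both crossings it is
  -- a power of `q⁻¹` times `q⁸ - q⁴ + 1`.
  refine ⟨c.weight - c.mirror.weight ^ 3 + c.mirror.weight ^ 7, [⟨.cap, i⟩, ⟨.cup, i⟩], ?_, ?_⟩
  · have h0 := q_mul_qInv
    rcases hc with rfl | rfl <;> simp only [Kind.weight, Kind.mirror]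
    · have e : q - qInv ^ 3 + qInv ^ 7 = qInv ^ 7 * (q ^ 8 - q ^ 4 + 1) := by
        have h7 : q ^ 7 * qInv ^ 7 = 1 := by rw [← mul_pow, h0, one_pow]
        have h4 : q ^ 4 * qInv ^ 4 = 1 := by rw [← mul_pow, h0, one_pow]
        linear_combination (-q) * h7 + qInv ^ 3 * h4
      rw [e, map_mul, hφ, mul_zero]
    · have e : qInv - q ^ 3 + q ^ 7 = qInv * (q ^ 8 - q ^ 4 + 1) := by
        linear_combination (q ^ 3 - q ^ 7) * h0
      rw [e, map_mul, hφ, mul_zero]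
  · intro f _ v
    simp only [List.cons_append, List.nil_append, stateSumFrom_crossing hc, stateSumFrom_cup,
      stateSumFrom_cap, capFactor_addArc_self, joinEnds_addArc_self, hc.circleValue_eq]
    generalize c.weight = α at *
    generalize c.mirror.weight = β at *
    -- The left side is the binomial coefficient sum `3α²β + 3αβ²δ + β³δ²`, from `e² = δe` and `e³ =
    -- δ²e`.
    have h3 : 3 * α ^ 2 * β + 3 * α * β ^ 2 * (-α ^ 2 - β ^ 2) + β ^ 3 * (-α ^ 2 - β ^ 2) ^ 2 =
        α - β ^ 3 + β ^ 7 := by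
      have h2 : α ^ 2 * β ^ 2 = 1 := by rw [← mul_pow, h1, one_pow]
      linear_combination (α - 3 * β ^ 3 - 3 * α ^ 2 * β) * h1 + (2 * β ^ 3 + α ^ 2 * β) * h2
    linear_combination (capFactor f i * stateSumFrom (addArc i (joinEnds i f)) v) * h3

/-! ### Invariance -/

theorem IsotopyMove.mirror {x y : List Piece} (h : IsotopyMove x y) :
    IsotopyMove (x.map Piece.mirror) (y.map Piece.mirror) := by
  cases h with
  | exchange a b i d =>
    have := IsotopyMove.exchange a.mirror b.mirror i d
    rwa [a.inputs_mirror, a.outputs_mirror] at this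
  | zigzagLeft i => exact .zigzagLeft i
  | zigzagRight i => exact .zigzagRight i
  | slideCupOver i => exact .slideCupUnder i
  | slideCupUnder i => exact .slideCupOver i
  | slideCapOver i => exact .slideCapUnder i
  | slideCapUnder i => exact .slideCapOver i

theorem ReidemeisterMove.shift {x y : List Piece} (h : ReidemeisterMove x y) (s : ℕ) :
    ReidemeisterMove (x.map (Piece.shift s)) (y.map (Piece.shift s)) := by
  cases h <;> simp only [map_shift_cons, List.map_nil, ← add_assoc] <;> constructor <;> assumption

theorem ThreeMove.shift {x y : List Piece} (h : ThreeMove x y) (s : ℕ) :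
    ThreeMove (x.map (Piece.shift s)) (y.map (Piece.shift s)) := by
  cases h <;> simp only [map_shift_cons, List.map_nil] <;> constructor

/-- The move `(x, y)` multiplies state sums by `a`, and its mirror image by `a'`. -/
def ScalingMove (φ : Laurent →+* R) (a a' : Laurent) (x y : List Piece) : Prop :=
  ∀ (s k l : ℕ), IsDiagram k (x.map (Piece.shift s)) l →
    ProportionalSum φ k a (x.map (Piece.shift s)) (y.map (Piece.shift s)) ∧
    ProportionalSum φ k a' ((x.map Piece.mirror).map (Piece.shift s))
      ((y.map Piece.mirror).map (Piece.shift s))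

theorem map_mirror_shift (s : ℕ) (w : List Piece) :
    (w.map Piece.mirror).map (Piece.shift s) = (w.map (Piece.shift s)).map Piece.mirror := by
  simp [Piece.mirror, Piece.shift]

theorem IsotopyMove.scalingMove {x y : List Piece} (h : IsotopyMove x y) :
    ScalingMove φ 1 1 x y := fun s k l hx => by
  refine ⟨((h.shift s).sameSum hx).proportionalSum, ?_⟩
  refine ((h.mirror.shift s).sameSum (l := l) ?_).proportionalSum
  rw [map_mirror_shift]
  exact hx.mirror

/-- The factors are inverse already in `ℤ[q, q⁻¹]`, because mirroring inverts the weight of a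
crossing and the signs of R1 cancel in pairs. -/
theorem ReidemeisterMove.scalingMove {x y : List Piece} (h : ReidemeisterMove x y) :
    ∃ a a' : Laurent, a * a' = 1 ∧ ScalingMove φ a a' x y := by
  cases h with
  | r1Right a ha i =>
    refine ⟨-a.weight ^ 3, -a.mirror.weight ^ 3, ?_, fun s k l hx => ?_⟩
    · rw [neg_mul_neg, ← mul_pow, ha.weight_mul_mirror, one_pow]
    · have hi : s + i < k := hx.1
      exact ⟨proportionalSum_r1Right ha hi, proportionalSum_r1Right ha.mirror hi⟩
  | r1Left a ha i =>
    refine ⟨-a.weight ^ 3, -a.mirror.weight ^ 3, ?_, fun s k l hx => ?_⟩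
    · rw [neg_mul_neg, ← mul_pow, ha.weight_mul_mirror, one_pow]
    · have hi : s + i < k := by
        have := hx.2.1
        simp only [Piece.shift, ha.inputs, inputs_cup, outputs_cup] at this
        omega
      exact ⟨proportionalSum_r1Left ha hi, proportionalSum_r1Left ha.mirror hi⟩
  | r2 a ha i =>
    exact ⟨1, 1, one_mul 1, fun s k l _ => ⟨(sameSum_r2 ha k (s + i)).proportionalSum,
      (sameSum_r2 ha.mirror k (s + i)).proportionalSum⟩⟩
  | r3 a b c ha hb hc h i =>
    refine ⟨1, 1, one_mul 1, fun s k l hx => ?_⟩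
    have hi : s + i + 3 ≤ k := by
      have h1 := hx.1
      have h2 := hx.2.1
      simp only [Piece.shift, ha.inputs, hb.inputs, ha.outputs] at h1 h2
      omega
    exact ⟨(sameSum_r3 ha hb hc h hi).proportionalSum,
      (sameSum_r3 ha.mirror hb.mirror hc.mirror
        (h.imp (congrArg Kind.mirror) (congrArg Kind.mirror)) hi).proportionalSum⟩

theorem ThreeMove.scalingMove (hφ : φ (q ^ 8 - q ^ 4 + 1) = 0) {x y : List Piece}
    (h : ThreeMove x y) : ∃ a a' : Laurent, a * a' = 1 ∧ ScalingMove φ a a' x y := by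
  have key : ∀ (c : Kind) (i : ℕ), c.IsCrossing → ∃ a a' : Laurent, a * a' = 1 ∧
      ScalingMove φ a a' [⟨c, i⟩, ⟨c, i⟩, ⟨c, i⟩] [] := fun c i hc =>
    ⟨c.weight ^ 3, c.mirror.weight ^ 3, by rw [← mul_pow, hc.weight_mul_mirror, one_pow],
      fun s k l _ => ⟨proportionalSum_threeTwists hφ hc k (s + i),
        proportionalSum_threeTwists hφ hc.mirror k (s + i)⟩⟩
  cases h with
  | plus i => exact key _ i (Or.inl rfl)
  | minus i => exact key _ i (Or.inr rfl)

/-! ### Cancellation between a diagram and its mirror image. -/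

theorem TangleDiagram.P_eq_stateSum {m n : ℕ} (D : TangleDiagram m n) :
    D.P = (D.tensor D.mirror).platClosure.stateSum :=
  skeinForm_skein D D.mirror

/-- The move is carried out first in the left tensor factor and then, mirrored, in the right one,
with the closure of `D'` beside the mirror image of `D` as the intermediate stage. The total factor
is `a * a' = 1`. -/
theorem map_P_eq_of_scalingMove {m n : ℕ} {D D' : TangleDiagram m n} {a a' : Laurent}
    (ha : a * a' = 1) {u x y v : List Piece} (h : ScalingMove φ a a' x y)
    (h₁ : D.word = u ++ x ++ v) (h₂ : D'.word = u ++ y ++ v) : φ D.P = φ D'.P := by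
  have shift_zero : ∀ w : List Piece, w.map (Piece.shift 0) = w :=
    List.map_id'' fun p => by simp [Piece.shift]
  have e₁ : D.mirror.word = u.map Piece.mirror ++ x.map Piece.mirror ++ v.map Piece.mirror := by
    simp [TangleDiagram.mirror, h₁]
  have e₂ : D'.mirror.word = u.map Piece.mirror ++ y.map Piece.mirror ++ v.map Piece.mirror := by
    simp [TangleDiagram.mirror, h₂]
  have left : φ (D.tensor D.mirror).platClosure.stateSum =
      φ a * φ (D'.tensor D.mirror).platClosure.stateSum := by
    have hD := (D.tensor D.mirror).platClosure.isDiagram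
    rw [word_platClosure_left D _ h₁] at hD
    obtain ⟨_, hl, -⟩ := isDiagram_append.1 hD
    obtain ⟨k, hu, hx⟩ := isDiagram_append.1 hl
    -- The left factor is not displaced, so the shift is `0`; the right factor below is displaced by
    -- the `n` strands at the top of the left one.
    have := (h 0 k _ (by rwa [shift_zero])).1
    rw [shift_zero, shift_zero] at this
    simpa only [TangleDiagram.stateSum, word_platClosure_left D _ h₁,
      word_platClosure_left D' _ h₂] using this.map_stateSumFrom hu _
  have right : φ (D'.tensor D.mirror).platClosure.stateSum =
      φ a' * φ (D'.tensor D'.mirror).platClosure.stateSum := by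
    have hD := (D'.tensor D.mirror).platClosure.isDiagram
    rw [word_platClosure_right D' _ e₁] at hD
    obtain ⟨_, hl, -⟩ := isDiagram_append.1 hD
    obtain ⟨k, hu, hx⟩ := isDiagram_append.1 hl
    -- The closure exhibits the mirrored picture as stackable, while `ScalingMove` asks this of the
    -- original one; mirroring twice gives it back.
    have hx' := hx.mirror
    rw [map_mirror_shift, List.map_map, show Piece.mirror ∘ Piece.mirror = id from
      funext fun p => by simp [Piece.mirror, Kind.mirror_mirror], List.map_id] at hx'
    simpa only [TangleDiagram.stateSum, word_platClosure_right D' _ e₁,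
      word_platClosure_right D' _ e₂] using (h n k _ hx').2.map_stateSumFrom hu _
  rw [D.P_eq_stateSum, D'.P_eq_stateSum, left, right, ← mul_assoc, ← map_mul, ha, map_one, one_mul]

/-- Since the factors cancel to give an equality, each move need only be treated in one direction.
-/
theorem map_P_eq_of_threeEquivalent (hφ : φ (q ^ 8 - q ^ 4 + 1) = 0) {m n : ℕ}
    {D D' : TangleDiagram m n} (h : D.ThreeEquivalent D') : φ D.P = φ D'.P := by
  induction h with
  | rel D D' h =>
    rcases h with (⟨u, x, y, v, h, h₁, h₂⟩ | ⟨u, x, y, v, h, h₁, h₂⟩) | ⟨u, x, y, v, h, h₁, h₂⟩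
    · exact map_P_eq_of_scalingMove (one_mul 1) h.scalingMove h₁ h₂
    · obtain ⟨a, a', ha, h⟩ := h.scalingMove (φ := φ)
      exact map_P_eq_of_scalingMove ha h h₁ h₂
    · obtain ⟨a, a', ha, h⟩ := h.scalingMove hφ
      exact map_P_eq_of_scalingMove ha h h₁ h₂
  | refl D => rfl
  | symm _ _ _ ih => exact ih.symm
  | trans _ _ _ _ _ ih₁ ih₂ => exact ih₁.trans ih₂

end Proportional

/-! ### The primitive 24th roots of unity. -/

/-- The fourth power is `w ^ k` with `w = e^{πi/3}`, a root of `x² - x + 1`. Each listed `k` is `±1`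
modulo `6`, so `w ^ k` is `w` or the other root `1 - w`. -/
theorem rootOfUnity_relation {k : ℕ} (hk : k ∈ ({1, 5, 7, 11, 13, 17, 19, 23} : Finset ℕ)) :
    (rootOfUnity k : ℂ) ^ 8 - (rootOfUnity k : ℂ) ^ 4 + 1 = 0 := by
  have h4 : (rootOfUnity k : ℂ) ^ 4 = Complex.exp (Real.pi / 3 * Complex.I) ^ k := by
    rw [rootOfUnity, Units.val_mk0, ← Complex.exp_nat_mul, ← Complex.exp_nat_mul]
    congr 1
    push_cast
    ring
  have h8 : (rootOfUnity k : ℂ) ^ 8 = (Complex.exp (Real.pi / 3 * Complex.I) ^ k) ^ 2 := by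
    rw [← h4, ← pow_mul]
  have hw : Complex.exp (Real.pi / 3 * Complex.I) ^ 2 - Complex.exp (Real.pi / 3 * Complex.I) + 1
      = 0 := by
    have hcos : Complex.cos (Real.pi / 3) = 1 / 2 := by
      have := congrArg Complex.ofReal Real.cos_pi_div_three
      push_cast at this
      exact this
    have hsq := Complex.sin_sq_add_cos_sq (Real.pi / 3)
    rw [Complex.exp_mul_I]
    rw [hcos] at hsq ⊢
    -- The terms linear in `I` cancel because the cosine is `1/2`.
    linear_combination (Complex.sin (Real.pi / 3)) ^ 2 * Complex.I_sq - hsq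
  rw [h8, h4]
  generalize Complex.exp (Real.pi / 3 * Complex.I) = w at hw
  -- The multipliers here and in `h5` are the quotients of `w⁶ - 1` and `w⁵ + w - 1` by `w² - w +
  -- 1`.
  have h6 : w ^ 6 = 1 := by linear_combination (w ^ 4 + w ^ 3 - w - 1) * hw
  have h5 : w ^ 5 = 1 - w := by linear_combination (w ^ 3 + w ^ 2 - 1) * hw
  have red : w ^ k = w ^ (k % 6) := by
    conv_lhs => rw [← Nat.div_add_mod k 6, pow_add, pow_mul, h6, one_pow, one_mul]
  rw [red]
  have : k % 6 = 1 ∨ k % 6 = 5 := by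
    simp only [Finset.mem_insert, Finset.mem_singleton] at hk
    omega
  rcases this with e | e <;> rw [e]
  · rw [pow_one, hw]
  · rw [h5]
    linear_combination hw

theorem eval_relation {k : ℕ} (hk : k ∈ ({1, 5, 7, 11, 13, 17, 19, 23} : Finset ℕ)) :
    LaurentPolynomial.eval₂ (Int.castRingHom ℂ) (rootOfUnity k) (q ^ 8 - q ^ 4 + 1) = 0 := by
  have : LaurentPolynomial.eval₂ (Int.castRingHom ℂ) (rootOfUnity k) q = rootOfUnity k := by
    simp [q]
  rw [map_add, map_sub, map_pow, map_pow, map_one, this, rootOfUnity_relation hk]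

theorem TangleDiagram.PAt_eq_of_threeEquivalent {m n k : ℕ}
    (hk : k ∈ ({1, 5, 7, 11, 13, 17, 19, 23} : Finset ℕ)) {D D' : TangleDiagram m n}
    (h : D.ThreeEquivalent D') : D.PAt k = D'.PAt k :=
  map_P_eq_of_threeEquivalent (eval_relation hk) h

end SkeinTangle

theorem mainTheorem1 (m n k : ℕ) (hk : k ∈ ({1, 5, 7, 11, 13, 17, 19, 23} : Finset ℕ)) :
    (∀ D D' : SkeinTangle.TangleDiagram m n, D.ThreeEquivalent D' → D.PAt k = D'.PAt k) ∧
    ∃ I : SkeinTangle.Tangle m n → ℂ,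
      (∀ D : SkeinTangle.TangleDiagram m n, I D.tangle = D.PAt k) ∧
      ∀ S T : SkeinTangle.Tangle m n, S.ThreeEquivalent T → I S = I T := by
  refine ⟨fun D D' h => SkeinTangle.TangleDiagram.PAt_eq_of_threeEquivalent hk h,
    -- An isotopy step is one of the generators of 3-equivalence, so the first claim already shows
    -- that the value descends to tangles.
    Quot.lift (fun D => D.PAt k) (fun D D' h =>
      SkeinTangle.TangleDiagram.PAt_eq_of_threeEquivalent hk (.rel _ _ (Or.inl h))),
    fun D => rfl, ?_⟩
  rintro _ _ ⟨D, D', rfl, rfl, h⟩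
  exact SkeinTangle.TangleDiagram.PAt_eq_of_threeEquivalent hk h
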